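/- Let $f\not\equiv 0$ be a meromorphic function in $\mathbb C$ of finite order $$\sigma=\limsup_{r\to\infty}\frac{\log^+ T(r,f)}{\log r}<\infty ,$$ where $T(r,f)$ is the Nevanlinna characteristic, and let $\eta\in\mathbb C\setminus\{0\}$. Let $\lambda'$ and $\lambda''$ be the exponents of convergence of the zeros and of the poles of $f$, that is, the infimum of all $\tau>0$ such that $\sum |a|^{-\tau}<\infty$, where $a$ runs over the nonzero zeros, respectively the nonzero poles, of $f$, repeated according to multiplicity. Put $\lambda=\max\{\lambda',\lambda''\}$ and $$\beta=\begin{cases}\max\{\sigma-2,\;2\lambda-2\}, & \lambda<1,\\ \max\{\sigma-2,\;\lambda-1\}, & \lambda\ge 1.\end{cases}$$ Then for every $\varepsilon>0$ there is a measurable set $E\subset(1,\infty)$ of finite logarithmic measure, $\int_E \frac{dr}{r}<\infty$, such that for all $z$ with $r=|z|\notin E\cup[0,1]$ neither $z$ nor $z+\eta$ is a zero or a pole of $f$, and $$2\pi i\,n_{z,\eta}+\log\frac{f(z+\eta)}{f(z)}=\eta\,\frac{f'(z)}{f(z)}+O\bigl(r^{\beta+\varepsilon}\bigr)$$ with integers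 $n_{z,\eta}$ depending on $z$ and $\eta$ ($\log$ being the principal branch), and equivalently $$\frac{f(z+\eta)}{f(z)}=\exp\Bigl(\eta\,\frac{f'(z)}{f(z)}+O\bigl(r^{\beta+\varepsilon}\bigr)\Bigr).$$ Here $O(r^{\beta+\varepsilon})$ stands for a function $R(z)$ for which there are $r_0,K>0$ with $|R(z)|\le K r^{\beta+\varepsilon}$ whenever $|z|=r>r_0$. -/

import Mathlib

open Set Filter Topology MeasureTheory

noncomputable section

namespace MeromorphicGrowth

/-- The logarithmic measure `∫_{E ∩ (1,∞)} dr / r` of a set of positive reals. -/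
def logMeasure (E : Set ℝ) : ENNReal :=
  ∫⁻ r in E ∩ Ioi 1, ENNReal.ofReal (1 / r)

/-- The order of growth `limsup_{r → ∞} log⁺ T(r, f) / log r`, where `T(r, f)` is the Nevanlinna
characteristic `m(r, f) + N(r, f)`. The positive part of the logarithm only matters for
constant functions (whose order is `0`). -/
def order (f : ℂ → ℂ) : EReal :=
  limsup (fun r : ℝ =>
    ((Real.posLog (ValueDistribution.characteristic f ⊤ r) / Real.log r : ℝ) : EReal)) atTop

/-- The exponent of convergence of a locally finite family of points of `ℂ`, the point `a` being
repeated `D a` times (`D ≥ 0`): the infimum of all `τ > 0` for which `∑_{a ≠ 0} D a * |a| ^ (-τ)`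
converges (`⊤` if there is no such `τ`). -/
def exponentOfConvergence (D : Function.locallyFinsupp ℂ ℤ) : EReal :=
  sInf ((fun τ : ℝ => (τ : EReal)) ''
    {τ : ℝ | 0 < τ ∧ Summable fun a : {a : ℂ // a ≠ 0} => (D a : ℝ) * ‖(a : ℂ)‖ ^ (-τ)})

/-- Exponent of convergence of the zeros of `f`, counted with multiplicity. -/
def zerosExponent (f : ℂ → ℂ) : EReal :=
  exponentOfConvergence (MeromorphicOn.divisor f univ)⁺

/-- Exponent of convergence of the poles of `f`, counted with multiplicity. -/
def polesExponent (f : ℂ → ℂ) : EReal :=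
  exponentOfConvergence (MeromorphicOn.divisor f univ)⁻

/-- The exponent `β` as a function of the order `σ` and of the exponent of convergence `lam`. -/
def beta (σ lam : ℝ) : ℝ :=
  if lam < 1 then max (σ - 2) (2 * lam - 2) else max (σ - 2) (lam - 1)

/-- `g(z) = O(ψ(r))` with `r = |z|`, as `r → ∞`. -/
def IsBigOModulus (g : ℂ → ℂ) (ψ : ℝ → ℝ) : Prop :=
  ∃ r₀ > 0, ∃ K > 0, ∀ z : ℂ, r₀ < ‖z‖ → ‖g z‖ ≤ K * ψ ‖z‖

end MeromorphicGrowth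

end

/-! On the disk of radius `R = 3|z|` write `f = g · ∏ (z - a) ^ D a`, with `g` analytic and
zero-free. Taking logarithms in `f(z+η)/f(z)` and removing the linear term `η f'/f` leaves two
remainders: that of `log g`, and the sum over the zeros and poles `a` of `D a * (log(1+w) - w)` with
`w = η/(z-a)`.

The first is a Taylor remainder of the Schwarz integral of `log|g|`
(`exists_quotient_eq_exp_of_ne_zero`): the kernel contributes `O(r^(-2))`, and the circle mean of
`|log|g||` is `O(r^(σ+ε) + r^(λ+ε))` by the first main theorem and a count of the `a`
(`exists_circleAverage_factor_le`).

For the second, `log(1+w) - w` is bounded both linearly and quadratically in `w` and `w/(1+w) =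
η/(z-(a-η))`, so it suffices to bound the sums of `1/||z|-|a||` and `1/||z|-|a-η||` over `a`.
Instead of a Cartan-type covering, `exists_exceptional_rpow` integrates a `p`-th power, `p < 1`, of
the reciprocal distances against a weight and applies Chebyshev's inequality; this gives `r^(λ-1+ε)`
off a set of finite logarithmic measure. The linear bound then yields the exponent `λ-1`, used for
`λ ≥ 1`, and the quadratic one yields `2λ-2`, used for `λ < 1`. -/

namespace MeromorphicGrowth

/-! ### Elementary bounds for `log(1+w) - w`. -/

section LogEstimates

lemma log_norm_one_add_le (w : ℂ) : Real.log ‖1 + w‖ ≤ ‖w‖ := by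
  rcases eq_or_ne (1 + w) 0 with h | h
  · simp [h]
  · have h₁ := Real.log_le_sub_one_of_pos (norm_pos_iff.2 h)
    have h₂ := norm_add_le 1 w
    rw [norm_one] at h₂
    linarith

/-- The lower bound is the upper bound `log_norm_one_add_le` applied to `1/(1+w) = 1 - w/(1+w)`. -/
lemma abs_log_norm_one_add_le {w : ℂ} (hw : 1 + w ≠ 0) :
    |Real.log ‖1 + w‖| ≤ ‖w‖ + ‖w / (1 + w)‖ := by
  rw [abs_le]
  constructor
  · have h := log_norm_one_add_le (-(w / (1 + w)))
    have h' : 1 + -(w / (1 + w)) = (1 + w)⁻¹ := by field_simp; ring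
    rw [h', norm_inv, Real.log_inv, norm_neg] at h
    linarith [norm_nonneg w]
  · linarith [log_norm_one_add_le w, norm_nonneg (w / (1 + w))]

lemma norm_log_one_add_sub_le_of_half_lt {w : ℂ} (hw : 1 + w ≠ 0) :
    ‖Complex.log (1 + w) - w‖ ≤ 2 * ‖w‖ + ‖w / (1 + w)‖ + 4 := by
  have h₁ : ‖Complex.log (1 + w)‖ ≤ |Real.log ‖1 + w‖| + |(1 + w).arg| := by
    have := Complex.norm_le_abs_re_add_abs_im (Complex.log (1 + w))
    rwa [Complex.log_re, Complex.log_im] at this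
  have h₂ := Complex.abs_arg_le_pi (1 + w)
  have h₃ := abs_log_norm_one_add_le hw
  have h₄ := norm_sub_le (Complex.log (1 + w)) w
  linarith [Real.pi_le_four]

lemma norm_log_one_add_sub_le_sq_of_le_half {w : ℂ} (hw : ‖w‖ ≤ 1 / 2) :
    ‖Complex.log (1 + w) - w‖ ≤ ‖w‖ ^ 2 := by
  have h₁ := Complex.norm_log_one_add_sub_self_le (z := w) (by linarith)
  have h₂ : (1 - ‖w‖)⁻¹ ≤ 2 := by
    rw [inv_le_comm₀ (by linarith) (by norm_num)]
    linarith
  nlinarith [sq_nonneg ‖w‖]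

/-- The term `w/(1+w)` pays for the singularity at `w = -1`; for `‖w‖ > 1/2` the additive constant
from the argument is absorbed by `‖w‖`. In the quadratic version below it is absorbed by `‖w‖ ^ 2`.
-/
lemma norm_log_one_add_sub_le {w : ℂ} (hw : 1 + w ≠ 0) :
    ‖Complex.log (1 + w) - w‖ ≤ 10 * (‖w‖ + ‖w / (1 + w)‖) := by
  have h₀ := norm_nonneg (w / (1 + w))
  rcases le_or_gt ‖w‖ (1 / 2) with h | h
  · have := norm_log_one_add_sub_le_sq_of_le_half h
    nlinarith [norm_nonneg w]
  · linarith [norm_log_one_add_sub_le_of_half_lt hw]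

lemma norm_log_one_add_sub_le_sq {w : ℂ} (hw : 1 + w ≠ 0) :
    ‖Complex.log (1 + w) - w‖ ≤ 25 * (‖w‖ ^ 2 + ‖w / (1 + w)‖ ^ 2) := by
  have h₀ := sq_nonneg ‖w / (1 + w)‖
  rcases le_or_gt ‖w‖ (1 / 2) with h | h
  · have := norm_log_one_add_sub_le_sq_of_le_half h
    nlinarith [sq_nonneg ‖w‖]
  · nlinarith [norm_log_one_add_sub_le_of_half_lt hw, sq_nonneg (‖w / (1 + w)‖ - 1)]

end LogEstimates

/-! ### Zero-free functions: the Schwarz integral and its first-order expansion. -/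

section NonvanishingQuotient

open Real Metric

/-- The kernel is `-1 + 2ζ/(ζ-w)`, with `w`-derivative `2ζ/(ζ-w)^2`; the right side is its exact
first-order Taylor remainder. -/
lemma herglotzRieszKernel_taylor {w η ζ : ℂ} (h₁ : ζ - w ≠ 0) (h₂ : ζ - (w + η) ≠ 0) :
    herglotzRieszKernel 0 (w + η) ζ - herglotzRieszKernel 0 w ζ - η * (2 * ζ / (ζ - w) ^ 2)
      = 2 * ζ * η ^ 2 / ((ζ - w) ^ 2 * (ζ - (w + η))) := by
  simp only [herglotzRieszKernel_def, sub_zero]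
  field_simp
  ring

lemma norm_herglotzRieszKernel_taylor_le {w η ζ : ℂ} {R : ℝ} (hζ : ‖ζ‖ = R)
    (hR : ‖w‖ + ‖η‖ < R) :
    ‖herglotzRieszKernel 0 (w + η) ζ - herglotzRieszKernel 0 w ζ - η * (2 * ζ / (ζ - w) ^ 2)‖
      ≤ 2 * R * ‖η‖ ^ 2 / ((R - ‖w‖) ^ 2 * (R - ‖w‖ - ‖η‖)) := by
  have hη := norm_nonneg η
  have h₁ : R - ‖w‖ ≤ ‖ζ - w‖ := hζ ▸ norm_sub_norm_le ζ w
  have h₂ : R - ‖w‖ - ‖η‖ ≤ ‖ζ - (w + η)‖ := by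
    have := norm_sub_norm_le ζ (w + η)
    have := norm_add_le w η
    linarith
  have h₃ : ζ - w ≠ 0 := norm_pos_iff.1 (by linarith)
  have h₄ : ζ - (w + η) ≠ 0 := norm_pos_iff.1 (by linarith)
  rw [herglotzRieszKernel_taylor h₃ h₄, norm_div, norm_mul, norm_mul, norm_mul, norm_pow, norm_pow,
    hζ, Complex.norm_two]
  have h₅ : 0 < R - ‖w‖ := by linarith
  have h₆ : 0 < R - ‖w‖ - ‖η‖ := by linarith
  have h₇ : 0 ≤ R := by linarith [norm_nonneg w]
  gcongr

lemma norm_circleAverage_le {F : ℂ → ℂ} {u : ℂ → ℝ} {R : ℝ} (hu : CircleIntegrable u 0 R)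
    (hF : ∀ ζ ∈ sphere (0 : ℂ) |R|, ‖F ζ‖ ≤ u ζ) :
    ‖circleAverage F 0 R‖ ≤ circleAverage u 0 R := by
  rw [circleAverage, circleAverage, norm_smul, norm_eq_abs, abs_of_pos (by positivity), smul_eq_mul]
  gcongr
  refine intervalIntegral.norm_integral_le_of_norm_le (by positivity) ?_ hu
  exact Eventually.of_forall fun θ _ => hF _ (circleMap_mem_sphere' 0 R θ)

/-- The logarithm of a zero-free function on a disk, represented by the Schwarz integral. -/
lemma exists_exp_schwarz_eq {g : ℂ → ℂ} {R : ℝ} (hg : AnalyticOnNhd ℂ g (closedBall 0 R))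
    (hg0 : ∀ z ∈ closedBall 0 R, g z ≠ 0) (hR : 0 < R) :
    ∃ c : ℂ, c ≠ 0 ∧ ∀ w ∈ ball (0 : ℂ) R,
      Complex.exp (circleAverage (fun ζ => herglotzRieszKernel 0 w ζ • (log ‖g ζ‖ : ℂ)) 0 R)
        = c * g w := by
  set H : ℂ → ℂ := fun w =>
    circleAverage (fun ζ => herglotzRieszKernel 0 w ζ • (log ‖g ζ‖ : ℂ)) 0 R with hH
  have hcont : ContinuousOn (fun ζ => log ‖g ζ‖) (sphere 0 R) := by
    refine ContinuousOn.log ((hg.continuousOn.mono sphere_subset_closedBall).norm) fun z hz => ?_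
    exact norm_ne_zero_iff.2 (hg0 z (sphere_subset_closedBall hz))
  have hint : CircleIntegrable (fun ζ => log ‖g ζ‖) 0 R := hcont.circleIntegrable hR.le
  have hint' : CircleIntegrable (fun ζ => (log ‖g ζ‖ : ℂ)) 0 R :=
    (Complex.continuous_ofReal.comp_continuousOn hcont).circleIntegrable hR.le
  have hHre : ∀ w ∈ ball (0 : ℂ) R, (H w).re = log ‖g w‖ := fun w hw => by
    rw [hH, re_circleAverage_herglotzRieszKernel_smul hint hw]
    exact InnerProductSpace.HarmonicOnNhd.circleAverage_re_herglotzRieszKernel_smul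
      (fun x hx => (hg x hx).harmonicAt_log_norm (hg0 x hx)) hw
  -- `Re H` is the Poisson integral of the harmonic function `log|g|`, hence equals it; so `q` has
  -- modulus one and is constant by the maximum principle.
  set q : ℂ → ℂ := fun w => Complex.exp (H w) / g w with hq
  have hqn : ∀ w ∈ ball (0 : ℂ) R, ‖q w‖ = 1 := fun w hw => by
    have := hg0 w (ball_subset_closedBall hw)
    rw [hq, norm_div, Complex.norm_exp, hHre w hw, exp_log (norm_pos_iff.2 this),
      div_self (norm_ne_zero_iff.2 this)]
  have hqd : DifferentiableOn ℂ q (ball 0 R) := fun w hw =>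
    (((hasDerivAt_circleAverage_herglotzRieszKernel_smul hint' hw).differentiableAt.cexp).div
      (hg w (ball_subset_closedBall hw)).differentiableAt
      (hg0 w (ball_subset_closedBall hw))).differentiableWithinAt
  have h0 : (0 : ℂ) ∈ ball (0 : ℂ) R := mem_ball_self hR
  have hconst := Complex.eqOn_of_isPreconnected_of_isMaxOn_norm (convex_ball (0 : ℂ) R).isPreconnected
    isOpen_ball hqd h0 (fun w hw => by simp [hqn w hw, hqn 0 h0])
  refine ⟨q 0, norm_ne_zero_iff.1 (by simp [hqn 0 h0]), fun w hw => ?_⟩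
  have := hconst hw
  rw [Function.const_apply, hq, div_eq_iff (hg0 w (ball_subset_closedBall hw))] at this
  exact this

/-- First order expansion of `log g` on a disk where `g` has no zeros. -/
lemma exists_quotient_eq_exp_of_ne_zero {g : ℂ → ℂ} {R : ℝ}
    (hg : AnalyticOnNhd ℂ g (closedBall 0 R)) (hg0 : ∀ z ∈ closedBall 0 R, g z ≠ 0)
    {z η : ℂ} (hz : ‖z‖ + ‖η‖ < R) :
    ∃ ρ : ℂ, g (z + η) / g z = Complex.exp (η * (deriv g z / g z) + ρ) ∧
      ‖ρ‖ ≤ 2 * R * ‖η‖ ^ 2 / ((R - ‖z‖) ^ 2 * (R - ‖z‖ - ‖η‖))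
        * circleAverage (fun ζ => |log ‖g ζ‖|) 0 R := by
  have hη := norm_nonneg η
  have hz0 := norm_nonneg z
  have hR : 0 < R := by linarith
  have hcont : ContinuousOn (fun ζ => log ‖g ζ‖) (sphere 0 R) := by
    refine ContinuousOn.log ((hg.continuousOn.mono sphere_subset_closedBall).norm) fun z hz => ?_
    exact norm_ne_zero_iff.2 (hg0 z (sphere_subset_closedBall hz))
  have hint' : CircleIntegrable (fun ζ => (log ‖g ζ‖ : ℂ)) 0 R :=
    (Complex.continuous_ofReal.comp_continuousOn hcont).circleIntegrable hR.le
  obtain ⟨c, hc, hexp⟩ := exists_exp_schwarz_eq hg hg0 hR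
  set H : ℂ → ℂ := fun w =>
    circleAverage (fun ζ => herglotzRieszKernel 0 w ζ • (log ‖g ζ‖ : ℂ)) 0 R with hH
  have hz₁ : z ∈ ball (0 : ℂ) R := by simpa using by linarith
  have hz₂ : z + η ∈ ball (0 : ℂ) R := by simpa using (norm_add_le z η).trans_lt hz
  have hgz := hg0 z (ball_subset_closedBall hz₁)
  have hHd := hasDerivAt_circleAverage_herglotzRieszKernel_smul hint' hz₁
  set H' := circleAverage (fun ζ => (2 * ζ / (ζ - z) ^ 2) • (log ‖g ζ‖ : ℂ)) 0 R with hH'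
  have hderiv : deriv g z / g z = H' := by
    have h₁ : HasDerivAt (fun w => c * g w) (Complex.exp (H z) * H') z :=
      hHd.cexp.congr_of_eventuallyEq
        (by filter_upwards [isOpen_ball.mem_nhds hz₁] with w hw using (hexp w hw).symm)
    have h₂ := ((hg z (ball_subset_closedBall hz₁)).differentiableAt.hasDerivAt.const_mul c).unique h₁
    rw [hexp z hz₁] at h₂
    field_simp
    have := mul_left_cancel₀ hc (h₂.trans (mul_assoc _ _ _))
    rw [this]
  -- The remainder is that of the Schwarz integral `H`, whose derivative at `z` is `g'/g`; the
  -- constant `c` has cancelled.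
  refine ⟨H (z + η) - H z - η * H', ?_, ?_⟩
  · rw [hderiv, show η * H' + (H (z + η) - H z - η * H') = H (z + η) - H z by ring, Complex.exp_sub,
      hexp z hz₁, hexp _ hz₂]
    field_simp
  · have hi : ∀ w ∈ ball (0 : ℂ) R, CircleIntegrable
        (fun ζ => herglotzRieszKernel 0 w ζ • (log ‖g ζ‖ : ℂ)) 0 R := fun w hw =>
      hint'.continuousOn_smul (continuousOn_herglotzRieszKernel_sphere hw)
    have hi' : CircleIntegrable (fun ζ => η • ((2 * ζ / (ζ - z) ^ 2) • (log ‖g ζ‖ : ℂ))) 0 R := by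
      refine ContinuousOn.circleIntegrable hR.le ?_
      have h₁ : ContinuousOn (fun ζ : ℂ => 2 * ζ / (ζ - z) ^ 2) (sphere 0 R) := by
        refine ContinuousOn.div (by fun_prop) (by fun_prop) fun ζ hζ => ?_
        refine pow_ne_zero _ (sub_ne_zero.2 ?_)
        rintro rfl
        simp only [mem_sphere_iff_norm, sub_zero] at hζ
        linarith
      exact (h₁.fun_smul (Complex.continuous_ofReal.comp_continuousOn hcont)).const_smul η
    have heq : H (z + η) - H z - η * H' = circleAverage (fun ζ =>
        (herglotzRieszKernel 0 (z + η) ζ - herglotzRieszKernel 0 z ζ - η * (2 * ζ / (ζ - z) ^ 2))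
          • (log ‖g ζ‖ : ℂ)) 0 R := by
      rw [hH, hH', ← smul_eq_mul, ← circleAverage_fun_smul, ← circleAverage_fun_sub (hi _ hz₂) (hi _ hz₁),
        ← circleAverage_fun_sub (f₁ := fun ζ => _ - _) ((hi _ hz₂).sub (hi _ hz₁)) hi']
      congr 1
      ext ζ
      simp only [smul_eq_mul]
      ring
    rw [heq, ← smul_eq_mul, ← circleAverage_fun_smul]
    refine norm_circleAverage_le ?_ fun ζ hζ => ?_
    · exact ContinuousOn.circleIntegrable hR.le (continuousOn_const.fun_smul hcont.abs)
    · rw [abs_of_pos hR] at hζ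
      rw [norm_smul, Complex.norm_real, norm_eq_abs, smul_eq_mul]
      gcongr
      exact norm_herglotzRieszKernel_taylor_le (by simpa using hζ) hz

end NonvanishingQuotient

/-! ### Exceptional radii of finite logarithmic measure. -/

section ExceptionalSet

open Real

lemma lintegral_Ioc_rpow {b p : ℝ} (hb : 0 ≤ b) (hp : p < 1) :
    ∫⁻ u in Ioc 0 b, ENNReal.ofReal (u ^ (-p)) = ENNReal.ofReal (b ^ (1 - p) / (1 - p)) := by
  have hi : IntervalIntegrable (fun u : ℝ => u ^ (-p)) volume 0 b :=
    intervalIntegral.intervalIntegrable_rpow' (by linarith)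
  rw [← ofReal_integral_eq_lintegral_ofReal ((intervalIntegrable_iff_integrableOn_Ioc_of_le hb).1 hi),
    ← intervalIntegral.integral_of_le hb, integral_rpow (Or.inl (by linarith)),
    zero_rpow (by linarith), sub_zero, neg_add_eq_sub]
  exact (ae_restrict_iff' measurableSet_Ioc).2 (Eventually.of_forall fun u hu => rpow_nonneg hu.1.le _)

lemma lintegral_Ioi_rpow {c τ : ℝ} (hc : 0 < c) (hτ : 0 < τ) :
    ∫⁻ s in Ioi c, ENNReal.ofReal (s ^ (-τ - 1)) = ENNReal.ofReal (c ^ (-τ) / τ) := by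
  rw [← ofReal_integral_eq_lintegral_ofReal (integrableOn_Ioi_rpow_of_lt (by linarith) hc),
    integral_Ioi_rpow_of_lt (by linarith) hc]
  · congr 1
    rw [sub_add_cancel, neg_div_neg_eq]
  · exact (ae_restrict_iff' measurableSet_Ioi).2
      (Eventually.of_forall fun u hu => rpow_nonneg (hc.trans hu).le _)

lemma lintegral_abs_sub_rpow_le {b p : ℝ} (hb : 0 ≤ b) (hp0 : 0 < p) (hp : p < 1) (t : ℝ)
    {S : Set ℝ} (hS : MeasurableSet S) (hSb : ∀ s ∈ S, |s - t| ≤ b) :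
    ∫⁻ s in S, ENNReal.ofReal (|s - t| ^ (-p)) ≤ 2 * ENNReal.ofReal (b ^ (1 - p) / (1 - p)) := by
  set F : ℝ → ENNReal := (Ioc 0 b).indicator fun u => ENNReal.ofReal (u ^ (-p)) with hF
  have hFm : Measurable F := Measurable.indicator (by fun_prop) measurableSet_Ioc
  have hFi : ∫⁻ u, F u = ENNReal.ofReal (b ^ (1 - p) / (1 - p)) := by
    rw [hF, lintegral_indicator measurableSet_Ioc, lintegral_Ioc_rpow hb hp]
  calc ∫⁻ s in S, ENNReal.ofReal (|s - t| ^ (-p))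
      ≤ ∫⁻ s in S, (F (s - t) + F (t - s)) := by
        refine setLIntegral_mono' hS fun s hs => ?_
        rcases lt_trichotomy s t with h | rfl | h
        · have h₁ : |s - t| = t - s := by rw [abs_of_neg (by linarith)]; ring
          have h₂ : t - s ∈ Ioc 0 b := ⟨by linarith, h₁ ▸ hSb s hs⟩
          rw [h₁, hF, indicator_of_mem h₂]
          exact le_add_self
        -- At `s = t` the integrand is `0 ^ (-p) = 0` by convention.
        · simp [zero_rpow (neg_ne_zero.2 hp0.ne')]
        · have h₁ : |s - t| = s - t := abs_of_pos (by linarith)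
          have h₂ : s - t ∈ Ioc 0 b := ⟨by linarith, h₁ ▸ hSb s hs⟩
          rw [h₁, hF, indicator_of_mem h₂]
          exact le_self_add
    _ ≤ ∫⁻ s, (F (s - t) + F (t - s)) := setLIntegral_le_lintegral _ _
    _ = 2 * ENNReal.ofReal (b ^ (1 - p) / (1 - p)) := by
        rw [lintegral_add_left (by fun_prop), lintegral_sub_right_eq_self F t,
          lintegral_sub_left_eq_self F t, hFi, two_mul]

lemma rpow_le_of_mem_Ioc {x s e : ℝ} (hx : 0 < x) (hs : s ∈ Ioc (x / 5) (2 * x)) :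
    s ^ e ≤ 5 ^ |e| * x ^ e := by
  have hs0 : 0 < s := by linarith [hs.1]
  rw [← div_le_iff₀ (rpow_pos_of_pos hx _), ← div_rpow hs0.le hx.le]
  have h₁ : 1 / 5 ≤ s / x := by rw [le_div_iff₀ hx]; linarith [hs.1]
  have h₂ : s / x ≤ 5 := by rw [div_le_iff₀ hx]; linarith [hs.2]
  rcases le_total 0 e with he | he
  · rw [abs_of_nonneg he]
    exact rpow_le_rpow (by positivity) h₂ he
  · rw [abs_of_nonpos he, rpow_neg (by norm_num), ← inv_rpow (by norm_num)]
    exact rpow_le_rpow_of_nonpos (by norm_num) (by linarith) he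

/-- The weighted integral of `|s - t| ^ (-p)` over `s ≥ max 1 (t / 4)`, for `0 < p < 1`. -/
lemma exists_lintegral_kernel_le {p τ : ℝ} (hp0 : 0 < p) (hp : p < 1) (hτ : 0 < τ) :
    ∃ C : ℝ, 0 ≤ C ∧ ∀ t : ℝ, 0 ≤ t →
      ∫⁻ s in Ioi 1 ∩ {s | t ≤ 4 * s}, ENNReal.ofReal (|s - t| ^ (-p) * s ^ (p - τ - 1))
        ≤ ENNReal.ofReal (C * (1 + t) ^ (-τ)) := by
  have h1p : 0 < 1 - p := by linarith
  set A : ℝ := 2 ^ p * (2 ^ (-τ) / τ) with hA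
  set B : ℝ := 5 ^ |p - τ - 1| * (2 * (2 ^ (1 - p) / (1 - p))) with hB
  have hA0 : 0 ≤ A := by positivity
  have hB0 : 0 ≤ B := by positivity
  refine ⟨B + A, by positivity, fun t ht => ?_⟩
  set x := 1 + t with hx
  have hx0 : 0 < x := by linarith
  -- From `1 < s` and `t ≤ 4s` follows `1 + t < 5s`. Up to `2x` the weight is comparable to a power
  -- of `x` and `|s - t| ≤ 2x`; beyond `2x`, `|s - t| ≥ s/2`.
  have hsub : Ioi 1 ∩ {s | t ≤ 4 * s} ⊆ Ioc (x / 5) (2 * x) ∪ Ioi (2 * x) := by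
    rintro s ⟨hs₁, hs₂⟩
    simp only [mem_Ioi, mem_ofPred_eq] at hs₁ hs₂
    rw [Ioc_union_Ioi_eq_Ioi (by linarith)]
    simp only [mem_Ioi]
    linarith
  refine (lintegral_mono_set hsub).trans ((lintegral_union_le _ _ _).trans ?_)
  rw [add_mul, ENNReal.ofReal_add (by positivity) (by positivity)]
  refine add_le_add ?_ ?_
  · calc ∫⁻ s in Ioc (x / 5) (2 * x), ENNReal.ofReal (|s - t| ^ (-p) * s ^ (p - τ - 1))
        ≤ ∫⁻ s in Ioc (x / 5) (2 * x), ENNReal.ofReal (5 ^ |p - τ - 1| * x ^ (p - τ - 1)) *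
            ENNReal.ofReal (|s - t| ^ (-p)) := by
          refine setLIntegral_mono' measurableSet_Ioc fun s hs => ?_
          rw [← ENNReal.ofReal_mul (by positivity), mul_comm]
          exact ENNReal.ofReal_le_ofReal
            (mul_le_mul_of_nonneg_right (rpow_le_of_mem_Ioc hx0 hs) (by positivity))
      _ ≤ ENNReal.ofReal (5 ^ |p - τ - 1| * x ^ (p - τ - 1)) *
            (2 * ENNReal.ofReal ((2 * x) ^ (1 - p) / (1 - p))) := by
          rw [lintegral_const_mul _ (by fun_prop)]
          gcongr
          refine lintegral_abs_sub_rpow_le (by positivity) hp0 hp t measurableSet_Ioc fun s hs => ?_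
          rw [abs_le]
          constructor <;> linarith [hs.1, hs.2]
      _ = ENNReal.ofReal (B * x ^ (-τ)) := by
          rw [← ENNReal.ofReal_ofNat 2, ← ENNReal.ofReal_mul (by norm_num),
            ← ENNReal.ofReal_mul (by positivity)]
          congr 1
          rw [hB, mul_rpow (by norm_num) hx0.le,
            show -τ = (p - τ - 1) + (1 - p) by ring, rpow_add hx0]
          ring
  · calc ∫⁻ s in Ioi (2 * x), ENNReal.ofReal (|s - t| ^ (-p) * s ^ (p - τ - 1))
        ≤ ∫⁻ s in Ioi (2 * x), ENNReal.ofReal (2 ^ p) * ENNReal.ofReal (s ^ (-τ - 1)) := by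
          refine setLIntegral_mono' measurableSet_Ioi fun s hs => ?_
          simp only [mem_Ioi] at hs
          have hs0 : 0 < s := by linarith
          rw [← ENNReal.ofReal_mul (by positivity)]
          refine ENNReal.ofReal_le_ofReal ?_
          have h₁ : |s - t| ^ (-p) ≤ (s / 2) ^ (-p) := by
            rw [abs_of_pos (by linarith)]
            exact rpow_le_rpow_of_nonpos (by linarith) (by linarith) (by linarith)
          calc |s - t| ^ (-p) * s ^ (p - τ - 1)
              ≤ (s / 2) ^ (-p) * s ^ (p - τ - 1) := by gcongr
            _ = 2 ^ p * s ^ (-τ - 1) := by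
              rw [show -τ - 1 = -p + (p - τ - 1) by ring, rpow_add hs0, div_rpow hs0.le (by norm_num),
                rpow_neg (by norm_num : (0 : ℝ) ≤ 2)]
              field_simp
      _ = ENNReal.ofReal (A * x ^ (-τ)) := by
          rw [lintegral_const_mul _ (by fun_prop), lintegral_Ioi_rpow (by positivity) hτ,
            ← ENNReal.ofReal_mul (by positivity), mul_rpow (by norm_num) hx0.le, hA]
          congr 1
          ring

/-- Off a set of finite logarithmic measure, a sum of fractional powers of the reciprocal distances
to the points of a sequence is controlled by the growth of the sequence. -/
lemma exists_exceptional_rpow {ι : Type*} [Countable ι] {m t : ι → ℝ} (hm : ∀ i, 0 ≤ m i)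
    (ht : ∀ i, 0 ≤ t i) {p τ : ℝ} (hp0 : 0 < p) (hp : p < 1) (hτ : 0 < τ)
    (hsum : Summable fun i => m i * (1 + t i) ^ (-τ)) :
    ∃ E : Set ℝ, E ⊆ Ioi 1 ∧ MeasurableSet E ∧ logMeasure E < ⊤ ∧
      ∀ s : ℝ, 1 < s → s ∉ E → ∀ F : Finset ι, (∀ i ∈ F, t i ≤ 4 * s) →
        ∑ i ∈ F, m i * |s - t i| ^ (-p) ≤ s ^ (τ - p) := by
  obtain ⟨C, hC, hker⟩ := exists_lintegral_kernel_le hp0 hp hτ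
  have hS : ∀ i, MeasurableSet {s : ℝ | t i ≤ 4 * s} := fun i =>
    measurableSet_le measurable_const (by fun_prop)
  set φ : ι → ℝ → ENNReal := fun i => {s : ℝ | t i ≤ 4 * s}.indicator fun s =>
    ENNReal.ofReal (m i) * ENNReal.ofReal (|s - t i| ^ (-p) * s ^ (p - τ - 1)) with hφ
  have hφm : ∀ i, Measurable (φ i) := fun i => Measurable.indicator (by fun_prop) (hS i)
  -- Chebyshev: on `E` the density `1/s` of logarithmic measure is dominated by a function of finite
  -- integral. Off `E`, dividing `1/s` by the weight `s ^ (p - τ - 1)` leaves `s ^ (τ - p)`.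
  set E : Set ℝ := Ioi 1 ∩ {s | ENNReal.ofReal (1 / s) < ∑' i, φ i s} with hE
  have hEm : MeasurableSet E := measurableSet_Ioi.inter
    (measurableSet_lt (by fun_prop) (Measurable.tsum hφm))
  refine ⟨E, inter_subset_left, hEm, ?_, fun s hs hsE F hF => ?_⟩
  · calc logMeasure E ≤ ∫⁻ s in E, ENNReal.ofReal (1 / s) := lintegral_mono_set inter_subset_left
      _ ≤ ∫⁻ s in E, ∑' i, φ i s := setLIntegral_mono' hEm fun s hs => hs.2.le
      _ ≤ ∫⁻ s in Ioi 1, ∑' i, φ i s := lintegral_mono_set inter_subset_left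
      _ = ∑' i, ∫⁻ s in Ioi 1, φ i s := lintegral_tsum fun i => (hφm i).aemeasurable
      _ ≤ ∑' i, ENNReal.ofReal (C * (m i * (1 + t i) ^ (-τ))) := by
        refine ENNReal.tsum_le_tsum fun i => ?_
        rw [hφ, setLIntegral_indicator (hS i), lintegral_const_mul _ (by fun_prop), inter_comm,
          mul_left_comm, ENNReal.ofReal_mul (hm i)]
        gcongr
        exact hker _ (ht i)
      _ < ⊤ := (hsum.mul_left C).tsum_ofReal_ne_top.lt_top
  · have hs0 : 0 < s := by linarith
    have h₁ : ∑' i, φ i s ≤ ENNReal.ofReal (1 / s) := by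
      by_contra h
      exact hsE ⟨hs, not_le.1 h⟩
    have h₂ := (ENNReal.sum_le_tsum (f := fun i => φ i s) F).trans h₁
    have h₃ : ∑ i ∈ F, φ i s
        = ENNReal.ofReal (∑ i ∈ F, m i * (|s - t i| ^ (-p) * s ^ (p - τ - 1))) := by
      rw [ENNReal.ofReal_sum_of_nonneg fun i _ => mul_nonneg (hm i) (by positivity)]
      refine Finset.sum_congr rfl fun i hi => ?_
      rw [hφ, ENNReal.ofReal_mul (hm i)]
      exact indicator_of_mem (show s ∈ {s : ℝ | t i ≤ 4 * s} from hF i hi) _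
    rw [h₃, ENNReal.ofReal_le_ofReal_iff (by positivity)] at h₂
    simp_rw [← mul_assoc] at h₂
    rw [← Finset.sum_mul, ← le_div_iff₀ (by positivity)] at h₂
    refine h₂.trans_eq ?_
    rw [one_div, ← rpow_neg_one, ← rpow_sub hs0]
    congr 1
    ring

lemma rpow_sum_le_sum_rpow {ι : Type*} (F : Finset ι) {x : ι → ℝ} (hx : ∀ i, 0 ≤ x i) {p : ℝ}
    (hp0 : 0 < p) (hp : p ≤ 1) : (∑ i ∈ F, x i) ^ p ≤ ∑ i ∈ F, x i ^ p := by
  classical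
  induction F using Finset.induction_on with
  | empty => simp [zero_rpow hp0.ne']
  | insert a s ha ih =>
    rw [Finset.sum_insert ha, Finset.sum_insert ha]
    exact (rpow_add_le_add_rpow (hx a) (Finset.sum_nonneg fun i _ => hx i) hp0.le hp).trans
      (by gcongr)

/-- `|s - t|⁻¹` is not integrable across `t`, but its `p`-th power is. Subadditivity of `x ^ p`
transfers the bound, and `m ^ p ≤ m` since multiplicities are integers; taking `p`-th roots turns `τ
- p` into `τ/p - 1`. -/
lemma exists_exceptional_inv_of_countable {ι : Type*} [Countable ι] {m : ι → ℕ} {t : ι → ℝ}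
    (ht : ∀ i, 0 ≤ t i) {p τ : ℝ} (hp0 : 0 < p) (hp : p < 1) (hτ : 0 < τ)
    (hsum : Summable fun i => (m i : ℝ) * (1 + t i) ^ (-τ)) :
    ∃ E : Set ℝ, E ⊆ Ioi 1 ∧ MeasurableSet E ∧ logMeasure E < ⊤ ∧
      ∀ s : ℝ, 1 < s → s ∉ E → ∀ F : Finset ι, (∀ i ∈ F, t i ≤ 4 * s) →
        ∑ i ∈ F, (m i : ℝ) * |s - t i|⁻¹ ≤ s ^ (τ / p - 1) := by
  obtain ⟨E, hE₁, hEm, hEf, hE⟩ :=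
    exists_exceptional_rpow (fun i => Nat.cast_nonneg (m i)) ht hp0 hp hτ hsum
  refine ⟨E, hE₁, hEm, hEf, fun s hs hsE F hF => ?_⟩
  have hs0 : 0 < s := by linarith
  have hnn : ∀ i, 0 ≤ (m i : ℝ) * |s - t i|⁻¹ := fun i => by positivity
  have h₁ : (∑ i ∈ F, (m i : ℝ) * |s - t i|⁻¹) ^ p ≤ s ^ (τ - p) := by
    refine (rpow_sum_le_sum_rpow F hnn hp0 hp.le).trans ((Finset.sum_le_sum fun i _ => ?_).trans
      (hE s hs hsE F hF))
    rw [mul_rpow (by positivity) (by positivity), inv_rpow (abs_nonneg _), ← rpow_neg (abs_nonneg _)]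
    gcongr
    rcases Nat.eq_zero_or_pos (m i) with h | h
    · simp [h, zero_rpow hp0.ne']
    · exact rpow_le_self_of_one_le (by exact_mod_cast h) hp.le
  have h₂ := rpow_le_rpow (rpow_nonneg (Finset.sum_nonneg fun i _ => hnn i) p) h₁ (inv_nonneg.2 hp0.le)
  rw [rpow_rpow_inv (Finset.sum_nonneg fun i _ => hnn i) hp0.ne', ← rpow_mul hs0.le] at h₂
  refine h₂.trans_eq ?_
  congr 1
  field_simp

/-- Off a set of finite logarithmic measure, the sum of the reciprocal distances to the points of a
sequence, counted with multiplicity, is controlled by the growth of the sequence. -/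
lemma exists_exceptional_inv {ι : Type*} {m : ι → ℕ} {t : ι → ℝ} (hc : m.support.Countable)
    (ht : ∀ i, 0 ≤ t i) {p τ : ℝ} (hp0 : 0 < p) (hp : p < 1) (hτ : 0 < τ)
    (hsum : Summable fun i => (m i : ℝ) * (1 + t i) ^ (-τ)) :
    ∃ E : Set ℝ, E ⊆ Ioi 1 ∧ MeasurableSet E ∧ logMeasure E < ⊤ ∧
      ∀ s : ℝ, 1 < s → s ∉ E → ∀ F : Finset ι, (∀ i ∈ F, t i ≤ 4 * s) →
        ∑ i ∈ F, (m i : ℝ) * |s - t i|⁻¹ ≤ s ^ (τ / p - 1) := by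
  classical
  have : Countable {i // m i ≠ 0} := hc.to_subtype
  obtain ⟨E, hE₁, hEm, hEf, hE⟩ := exists_exceptional_inv_of_countable
    (m := fun i : {i // m i ≠ 0} => m i) (fun i => ht i) hp0 hp hτ (hsum.subtype _)
  refine ⟨E, hE₁, hEm, hEf, fun s hs hsE F hF => ?_⟩
  have h := hE s hs hsE (F.subtype fun i => m i ≠ 0)
    fun i hi => hF i (Finset.mem_subtype.1 hi)
  rw [Finset.sum_subtype_eq_sum_filter (fun i => (m i : ℝ) * |s - t i|⁻¹)] at h
  refine le_trans (le_of_eq (Finset.sum_filter_of_ne fun i _ hi => ?_).symm) h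
  exact fun h0 => hi (by simp [h0])

end ExceptionalSet

/-! ### From counting functions to convergent sums over zeros and poles. -/

section Growth

open Real ValueDistribution Function.locallyFinsuppWithin

/-- A point with `0 < |a| ≤ r` adds `D a * log(2r/|a|) ≥ D a * log 2` to the counting function at
`2r`; the origin adds `D 0 * log(2r)`. -/
lemma sum_mul_log_two_le_logCounting {D : Function.locallyFinsupp ℂ ℤ} (hD : 0 ≤ D) {r : ℝ}
    (hr : 1 ≤ r) {F : Finset ℂ} (hF : ∀ a ∈ F, ‖a‖ ≤ r) :
    (∑ a ∈ F, (D a : ℝ)) * log 2 ≤ logCounting D (2 * r) := by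
  classical
  set D' : Function.locallyFinsupp ℂ ℤ := ∑ a ∈ F, single a (D a) with hD'
  have hle : D' ≤ D := by
    intro z
    have : D' z = ∑ a ∈ F, single a (D a) z := by
      rw [hD', coe_sum, Finset.sum_apply]
    rw [this]
    simp only [single_apply]
    rw [Finset.sum_ite_eq F z]
    split_ifs
    · exact le_rfl
    · exact hD z
  refine le_trans ?_ (logCounting_le hle (by linarith : 1 ≤ 2 * r))
  rw [hD', map_sum, Finset.sum_apply, Finset.sum_mul]
  refine Finset.sum_le_sum fun a ha => ?_
  have har := hF a ha
  rw [logCounting_single_eq_log_sub_const (by linarith)]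
  refine mul_le_mul_of_nonneg_left ?_ (by exact_mod_cast hD a)
  rw [log_mul (by norm_num) (by linarith)]
  rcases eq_or_ne a 0 with rfl | h
  · simpa using log_nonneg hr
  · linarith [log_le_log (norm_pos_iff.2 h) har]

lemma eventually_characteristic_le_rpow {f : ℂ → ℂ} {σ : ℝ} (hσ : order f = (σ : EReal)) {δ : ℝ}
    (hδ : 0 < δ) : ∀ᶠ r in atTop, characteristic f ⊤ r ≤ r ^ (σ + δ) := by
  have h : order f < ((σ + δ : ℝ) : EReal) := by
    rw [hσ]
    exact_mod_cast lt_add_of_pos_right σ hδ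
  filter_upwards [eventually_lt_of_limsup_lt h, eventually_gt_atTop 1] with r hr hr1
  have hr' : posLog (characteristic f ⊤ r) < (σ + δ) * log r := by
    rwa [EReal.coe_lt_coe_iff, div_lt_iff₀ (log_pos hr1)] at hr
  rcases le_or_gt (characteristic f ⊤ r) 0 with hT | hT
  · exact hT.trans (by positivity)
  · rw [← log_le_log_iff hT (by positivity), log_rpow (by positivity)]
    exact (le_max_right _ _).trans hr'.le

lemma order_nonneg {f : ℂ → ℂ} {σ : ℝ} (hσ : order f = (σ : EReal)) : 0 ≤ σ := by
  rw [← EReal.coe_nonneg, ← hσ, order]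
  refine le_limsup_of_frequently_le' (Eventually.frequently ?_)
  filter_upwards [eventually_ge_atTop 1] with r hr
  exact_mod_cast div_nonneg posLog_nonneg (log_nonneg hr)

lemma exists_sum_le_of_logCounting_le {D : Function.locallyFinsupp ℂ ℤ} (hD : 0 ≤ D) {K s : ℝ}
    (hK : 0 ≤ K) (hs : 0 ≤ s) (hN : ∀ᶠ r in atTop, logCounting D r ≤ K * r ^ s) :
    ∃ C : ℝ, 0 ≤ C ∧ ∀ (k : ℕ) (F : Finset ℂ), (∀ a ∈ F, ‖a‖ ≤ k) →
      ∑ a ∈ F, (D a : ℝ) ≤ C * (1 + k : ℝ) ^ s := by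
  obtain ⟨r₀, hr₀⟩ := eventually_atTop.1 hN
  set c := max r₀ 1 with hc
  have hc1 : 1 ≤ c := le_max_right _ _
  refine ⟨K * (2 * c) ^ s / log 2, by positivity, fun k F hF => ?_⟩
  have hk : (0 : ℝ) ≤ k := Nat.cast_nonneg k
  have h₁ := sum_mul_log_two_le_logCounting hD (r := c + k) (by linarith)
    (fun a ha => (hF a ha).trans (by linarith))
  have h₂ := hr₀ (2 * (c + k)) (by linarith [le_max_left r₀ 1])
  have h₃ : (2 * (c + k)) ^ s ≤ (2 * c) ^ s * (1 + k : ℝ) ^ s := by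
    rw [← mul_rpow (by positivity) (by positivity)]
    exact rpow_le_rpow (by positivity) (by nlinarith) hs
  rw [div_mul_eq_mul_div, le_div_iff₀ (log_pos one_lt_two)]
  calc _ ≤ K * (2 * (c + k)) ^ s := h₁.trans h₂
    _ ≤ K * ((2 * c) ^ s * (1 + k : ℝ) ^ s) := by gcongr
    _ = _ := by ring

/-- Summation by parts: each term is dominated by the `k = ⌈|a|⌉` entry of a sum over `k ≥ |a|`;
after exchanging sums, the count `O((1+k)^s)` leaves `∑ (1+k)^(-2)`. The exponent is not sharp: it
only serves to show that exponents of convergence are finite. -/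
lemma summable_of_logCounting_le {D : Function.locallyFinsupp ℂ ℤ} (hD : 0 ≤ D) {K s : ℝ}
    (hK : 0 ≤ K) (hs : 0 ≤ s) (hN : ∀ᶠ r in atTop, logCounting D r ≤ K * r ^ s) :
    Summable fun a : ℂ => (D a : ℝ) * (1 + ‖a‖) ^ (-(s + 2)) := by
  obtain ⟨C, hC, hcount⟩ := exists_sum_le_of_logCounting_le hD hK hs hN
  have hDr : ∀ a, (0 : ℝ) ≤ D a := fun a => by exact_mod_cast hD a
  have hsum : Summable fun k : ℕ => (1 + k : ℝ) ^ (-2 : ℝ) := by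
    have := (summable_nat_add_iff 1).2 (Real.summable_nat_rpow.2 (by norm_num : (-2 : ℝ) < -1))
    simpa [add_comm] using this
  refine summable_of_sum_le (c := 2 ^ (s + 2) * (C * ∑' k : ℕ, (1 + k : ℝ) ^ (-2 : ℝ)))
    (fun a => mul_nonneg (hDr a) (by positivity)) fun F => ?_
  obtain ⟨M, hM⟩ : ∃ M : ℕ, ∀ a ∈ F, ⌈‖a‖⌉₊ < M := by
    refine ⟨F.sup (fun a => ⌈‖a‖⌉₊) + 1, fun a ha => Nat.lt_succ_of_le ?_⟩
    exact Finset.le_sup (f := fun a : ℂ => ⌈‖a‖⌉₊) ha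
  have hterm : ∀ a ∈ F, (1 + ‖a‖) ^ (-(s + 2)) ≤ 2 ^ (s + 2) *
      ∑ k ∈ Finset.range M, if ‖a‖ ≤ k then (1 + k : ℝ) ^ (-(s + 2)) else 0 := fun a ha => by
    set k := ⌈‖a‖⌉₊ with hk
    have h₁ : (1 + k : ℝ) ≤ 2 * (1 + ‖a‖) := by
      linarith [Nat.ceil_lt_add_one (norm_nonneg a), norm_nonneg a]
    have h₂ : (2 * (1 + ‖a‖)) ^ (-(s + 2)) ≤ (1 + k : ℝ) ^ (-(s + 2)) :=
      rpow_le_rpow_of_nonpos (by positivity) h₁ (by linarith)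
    have h₃ : (1 + k : ℝ) ^ (-(s + 2)) ≤
        ∑ k ∈ Finset.range M, if ‖a‖ ≤ k then (1 + k : ℝ) ^ (-(s + 2)) else 0 := by
      refine le_trans (le_of_eq ?_) (Finset.single_le_sum (f := fun k : ℕ =>
        if ‖a‖ ≤ k then (1 + k : ℝ) ^ (-(s + 2)) else 0) (fun i _ => ?_)
        (Finset.mem_range.2 (hM a ha)))
      · exact (if_pos (Nat.le_ceil _)).symm
      · split_ifs <;> positivity
    rw [mul_rpow (by norm_num) (by positivity), rpow_neg (by norm_num)] at h₂
    calc (1 + ‖a‖) ^ (-(s + 2))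
        = 2 ^ (s + 2) * ((2 ^ (s + 2))⁻¹ * (1 + ‖a‖) ^ (-(s + 2))) := by
          rw [mul_inv_cancel_left₀ (by positivity)]
      _ ≤ _ := by gcongr; exact h₂.trans h₃
  calc ∑ a ∈ F, (D a : ℝ) * (1 + ‖a‖) ^ (-(s + 2))
      ≤ ∑ a ∈ F, (D a : ℝ) * (2 ^ (s + 2) *
          ∑ k ∈ Finset.range M, if ‖a‖ ≤ k then (1 + k : ℝ) ^ (-(s + 2)) else 0) :=
        Finset.sum_le_sum fun a ha => mul_le_mul_of_nonneg_left (hterm a ha) (hDr a)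
    _ = 2 ^ (s + 2) * ∑ k ∈ Finset.range M, (1 + k : ℝ) ^ (-(s + 2)) *
          ∑ a ∈ F with ‖a‖ ≤ k, (D a : ℝ) := by
        simp_rw [mul_left_comm _ (2 ^ (s + 2) : ℝ), ← Finset.mul_sum, Finset.mul_sum,
          Finset.sum_filter]
        rw [Finset.sum_comm]
        refine Finset.sum_congr rfl fun k _ => Finset.sum_congr rfl fun a _ => ?_
        split_ifs <;> ring
    _ ≤ 2 ^ (s + 2) * ∑ k ∈ Finset.range M, C * (1 + k : ℝ) ^ (-2 : ℝ) := by
        refine mul_le_mul_of_nonneg_left (Finset.sum_le_sum fun k _ => ?_) (by positivity)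
        calc (1 + k : ℝ) ^ (-(s + 2)) * ∑ a ∈ F with ‖a‖ ≤ k, (D a : ℝ)
            ≤ (1 + k : ℝ) ^ (-(s + 2)) * (C * (1 + k : ℝ) ^ s) := by
              gcongr
              exact hcount k _ fun a ha => (Finset.mem_filter.1 ha).2
          _ = C * (1 + k : ℝ) ^ (-2 : ℝ) := by
              rw [show (-2 : ℝ) = -(s + 2) + s by ring, rpow_add (by positivity)]
              ring
    _ ≤ _ := by
        rw [← Finset.mul_sum]
        gcongr
        exact hsum.sum_le_tsum _ fun k _ => by positivity

/-- Local finiteness keeps the nonzero points away from `0`, where alone `|a|` and `1 + |a|` are not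
comparable. -/
lemma exponentOfConvergence_le {D : Function.locallyFinsupp ℂ ℤ} (hD : 0 ≤ D) {τ : ℝ} (hτ : 0 < τ)
    (hsum : Summable fun a : ℂ => (D a : ℝ) * (1 + ‖a‖) ^ (-τ)) :
    exponentOfConvergence D ≤ τ := by
  refine sInf_le ⟨τ, ⟨hτ, ?_⟩, rfl⟩
  obtain ⟨c, hc, hDc⟩ : ∃ c > 0, ∀ a : ℂ, a ≠ 0 → ‖a‖ < c → D a = 0 := by
    have h : ∀ᶠ a in 𝓝[≠] (0 : ℂ), D a = 0 := by
      rw [compl_eq_univ_sdiff]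
      exact D.eq_zero_codiscreteWithin.filter_mono
        (le_iSup₂ (f := fun x (_ : x ∈ univ) => 𝓝[univ \ {x}] x) (0 : ℂ) (mem_univ 0))
    rw [eventually_nhdsWithin_iff, Metric.eventually_nhds_iff] at h
    obtain ⟨c, hc, h⟩ := h
    exact ⟨c, hc, fun a ha hac => h (by simpa using hac) ha⟩
  refine Summable.of_nonneg_of_le (fun a => mul_nonneg (by exact_mod_cast hD _) (by positivity))
    (fun a => ?_) ((hsum.subtype {a : ℂ | a ≠ 0}).mul_left (((1 + c) / c) ^ τ))
  have ha : 0 < ‖(a : ℂ)‖ := norm_pos_iff.2 a.2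
  rcases lt_or_ge ‖(a : ℂ)‖ c with h | h
  · simp [hDc a a.2 h]
  · have h₁ : (1 + ‖(a : ℂ)‖) / ‖(a : ℂ)‖ ≤ (1 + c) / c := by
      rw [div_le_div_iff₀ ha hc]
      linarith
    have h₂ : ‖(a : ℂ)‖ ^ (-τ) ≤ ((1 + c) / c) ^ τ * (1 + ‖(a : ℂ)‖) ^ (-τ) := by
      calc ‖(a : ℂ)‖ ^ (-τ) = ((1 + ‖(a : ℂ)‖) / ‖(a : ℂ)‖) ^ τ * (1 + ‖(a : ℂ)‖) ^ (-τ) := by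
            rw [div_rpow (by positivity) ha.le, rpow_neg ha.le, rpow_neg (by positivity)]
            field_simp
        _ ≤ _ := by gcongr
    simp only [Function.comp_apply]
    rw [mul_left_comm]
    exact mul_le_mul_of_nonneg_left h₂ (by exact_mod_cast hD _)

lemma summable_of_exponentOfConvergence_lt {D : Function.locallyFinsupp ℂ ℤ} (hD : 0 ≤ D) {τ : ℝ}
    (h : exponentOfConvergence D < τ) :
    Summable fun a : ℂ => (D a : ℝ) * (1 + ‖a‖) ^ (-τ) := by
  obtain ⟨_, ⟨τ', ⟨hτ', hsum⟩, rfl⟩, hlt⟩ := sInf_lt_iff.1 h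
  have hlt : τ' < τ := EReal.coe_lt_coe_iff.1 hlt
  rw [← (finite_singleton (0 : ℂ)).summable_compl_iff]
  refine Summable.of_nonneg_of_le (fun a => mul_nonneg (by exact_mod_cast hD _) (by positivity))
    (fun a => ?_) hsum
  have ha : 0 < ‖(a : ℂ)‖ := norm_pos_iff.2 a.2
  refine mul_le_mul_of_nonneg_left ?_ (by exact_mod_cast hD _)
  calc (1 + ‖(a : ℂ)‖) ^ (-τ) ≤ (1 + ‖(a : ℂ)‖) ^ (-τ') :=
        rpow_le_rpow_of_exponent_le (by linarith) (by linarith)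
    _ ≤ ‖(a : ℂ)‖ ^ (-τ') := rpow_le_rpow_of_nonpos ha (by linarith) (by linarith)

end Growth

/-! ### Factoring out zeros and poles on a disk. -/

section Factorization

open Real ValueDistribution MeromorphicOn Metric

lemma meromorphicOrderAt_ne_top_of_not_eventually_zero {f : ℂ → ℂ} (hf : Meromorphic f)
    (hf0 : ¬ f =ᶠ[codiscrete ℂ] 0) (z : ℂ) : meromorphicOrderAt f z ≠ ⊤ := by
  intro hz
  apply hf0
  have htop : ∀ w, meromorphicOrderAt f w = ⊤ := fun w => by
    by_contra hw
    exact hf.meromorphicOn.meromorphicOrderAt_ne_top_of_isPreconnected isPreconnected_univ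
      (mem_univ w) (mem_univ z) hw hz
  refine mem_codiscrete.2 fun x => ?_
  rw [disjoint_principal_right, compl_compl]
  filter_upwards [meromorphicOrderAt_eq_top_iff.1 (htop x)] with w hw
  simpa using hw

/-- The complement of a codiscrete set is discrete, and discrete subsets of a hereditarily Lindelöf
space are countable. -/
lemma countable_compl_regular {f : ℂ → ℂ} (hf : Meromorphic f)
    (hord : ∀ z, meromorphicOrderAt f z ≠ ⊤) :
    {z | AnalyticAt ℂ f z ∧ f z ≠ 0}ᶜ.Countable := by
  rw [← inter_univ {z | AnalyticAt ℂ f z ∧ f z ≠ 0}ᶜ]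
  refine (HereditarilyLindelofSpace.isLindelof _).countable_of_isDiscrete
    (isDiscrete_of_codiscreteWithin ?_)
  rw [compl_compl]
  filter_upwards [hf.meromorphicOn.eventually_codiscreteWithin_analyticAt f,
    hf.meromorphicOn.eventually_codiscreteWithin_apply_ne_zero fun x _ => hord x] with z h₁ h₂
  exact ⟨h₁, h₂⟩

lemma divisor_eq_zero_of_regular {f : ℂ → ℂ} (hf : Meromorphic f) {z : ℂ} (hz : AnalyticAt ℂ f z)
    (hz0 : f z ≠ 0) : divisor f univ z = 0 := by
  rw [divisor_apply hf.meromorphicOn (mem_univ z), hz.meromorphicOrderAt_eq,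
    hz.analyticOrderAt_eq_zero.2 hz0]
  simp

/-- On a disk, a meromorphic function is a rational function with its zeros and poles, times a
zero-free analytic function. -/
lemma exists_factorization {f : ℂ → ℂ} (hf : Meromorphic f)
    (hord : ∀ z, meromorphicOrderAt f z ≠ ⊤) (R : ℝ) :
    ∃ (F : Finset ℂ) (g : ℂ → ℂ), (∀ a ∈ F, ‖a‖ ≤ R ∧ divisor f univ a ≠ 0) ∧
      AnalyticOnNhd ℂ g (closedBall 0 R) ∧ (∀ z ∈ closedBall 0 R, g z ≠ 0) ∧
      f =ᶠ[codiscreteWithin (closedBall 0 R)]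
        fun z => (∏ a ∈ F, (z - a) ^ divisor f univ a) * g z := by
  have hfin := (divisor f (closedBall (0 : ℂ) R)).finiteSupport (isCompact_closedBall 0 R)
  have hD : ∀ a ∈ closedBall (0 : ℂ) R, divisor f (closedBall 0 R) a = divisor f univ a :=
    fun a ha => by
      rw [divisor_apply hf.meromorphicOn ha, divisor_apply hf.meromorphicOn (mem_univ a)]
  have hmem : ∀ a ∈ hfin.toFinset, a ∈ closedBall (0 : ℂ) R := fun a ha =>
    (divisor f (closedBall (0 : ℂ) R)).supportWithinDomain (hfin.mem_toFinset.1 ha)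
  obtain ⟨g, hg, hg0, hfg⟩ := hf.meromorphicOn.extract_zeros_poles (fun u => hord u) hfin
  refine ⟨hfin.toFinset, g, fun a ha => ⟨by simpa using hmem a ha, ?_⟩, hg,
    fun z hz => hg0 ⟨z, hz⟩, ?_⟩
  · rw [← hD a (hmem a ha)]
    exact hfin.mem_toFinset.1 ha
  · filter_upwards [hfg] with z hz
    rw [hz, Pi.smul_apply', smul_eq_mul, Function.FactorizedRational.finprod_eq_fun hfin]
    congr 1
    dsimp only
    rw [finprod_eq_prod_of_mulSupport_subset (s := hfin.toFinset)]
    · exact Finset.prod_congr rfl fun a ha => by rw [hD a (hmem a ha)]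
    · intro a ha
      rw [hfin.coe_toFinset]
      intro h
      exact ha (by simp [h])

variable {f g : ℂ → ℂ} {F : Finset ℂ} {D : ℂ → ℤ} {R : ℝ}

/-- The factorization holds only off a discrete set; continuity of both sides at `z` extends it to
`z` itself. -/
lemma eventuallyEq_nhds_factorization {z : ℂ} (hz : AnalyticAt ℂ f z) (hzF : ∀ a ∈ F, z ≠ a)
    (hg : AnalyticAt ℂ g z) (hzR : ‖z‖ < R)
    (hfg : f =ᶠ[codiscreteWithin (closedBall 0 R)] fun z => (∏ a ∈ F, (z - a) ^ D a) * g z) :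
    f =ᶠ[𝓝 z] fun z => (∏ a ∈ F, (z - a) ^ D a) * g z := by
  have hcont : ContinuousAt (fun z => (∏ a ∈ F, (z - a) ^ D a) * g z) z := by
    refine ContinuousAt.mul (tendsto_finsetProd _ fun a ha => ?_) hg.continuousAt
    exact ContinuousAt.zpow₀ (by fun_prop) _ (Or.inl (sub_ne_zero.2 (hzF a ha)))
  rw [← hz.continuousAt.eventuallyEq_nhds_iff_eventuallyEq_nhdsNE hcont]
  have hball : closedBall (0 : ℂ) R ∈ 𝓝 z :=
    mem_of_superset (isOpen_ball.mem_nhds (by simpa using hzR)) ball_subset_closedBall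
  have h := mem_codiscreteWithin_iff_forall_mem_nhdsNE.1 hfg z (mem_of_mem_nhds hball)
  filter_upwards [h, mem_nhdsWithin_of_mem_nhds hball] with w hw hwR
  exact hw.resolve_right fun h => h hwR

lemma deriv_div_factorization {z : ℂ} (hzF : ∀ a ∈ F, z ≠ a) (hg : AnalyticAt ℂ g z)
    (hg0 : g z ≠ 0) (hfg : f =ᶠ[𝓝 z] fun z => (∏ a ∈ F, (z - a) ^ D a) * g z) :
    deriv f z / f z = (∑ a ∈ F, D a / (z - a)) + deriv g z / g z := by
  have hd : ∀ a ∈ F, DifferentiableAt ℂ (fun z => (z - a) ^ D a) z := fun a ha =>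
    DifferentiableAt.zpow (by fun_prop) (Or.inl (sub_ne_zero.2 (hzF a ha)))
  have hn : ∀ a ∈ F, (z - a) ^ D a ≠ 0 := fun a ha => zpow_ne_zero _ (sub_ne_zero.2 (hzF a ha))
  rw [hfg.deriv_eq, hfg.eq_of_nhds, ← logDeriv_apply, logDeriv_mul z (Finset.prod_ne_zero_iff.2 hn) hg0
    (DifferentiableAt.fun_finsetProd hd) hg.differentiableAt, 
    logDeriv_prod (f := fun a z => (z - a) ^ D a) hn hd, logDeriv_apply g]
  congr 1
  refine Finset.sum_congr rfl fun a _ => ?_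
  rw [logDeriv_fun_zpow (by fun_prop), logDeriv_apply]
  simp [div_eq_mul_inv]

/-- As the exponents are integers, the principal logarithm can be used in each factor. The linear
terms are split off to match the sum in `deriv_div_factorization`. -/
lemma prod_quotient_eq_exp {z η : ℂ} (hz : ∀ a ∈ F, z ≠ a) (hzη : ∀ a ∈ F, z + η ≠ a) :
    (∏ a ∈ F, (z + η - a) ^ D a) / (∏ a ∈ F, (z - a) ^ D a)
      = Complex.exp (η * (∑ a ∈ F, D a / (z - a)) +
        ∑ a ∈ F, D a * (Complex.log (1 + η / (z - a)) - η / (z - a))) := by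
  rw [← Finset.prod_div_distrib, Finset.mul_sum, ← Finset.sum_add_distrib, Complex.exp_sum]
  refine Finset.prod_congr rfl fun a ha => ?_
  have h₁ := sub_ne_zero.2 (hz a ha)
  have h₂ := sub_ne_zero.2 (hzη a ha)
  have h₃ : 1 + η / (z - a) = (z + η - a) / (z - a) := by field_simp; ring
  rw [show η * (D a / (z - a)) + D a * (Complex.log (1 + η / (z - a)) - η / (z - a))
    = D a * Complex.log (1 + η / (z - a)) by ring, Complex.exp_int_mul, h₃,
    Complex.exp_log (div_ne_zero h₂ h₁), div_zpow]

/-- The difference quotient of a meromorphic function, in terms of its factorization on a disk. -/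
lemma exists_quotient_eq_exp {z η : ℂ} (hz : AnalyticAt ℂ f z) (hzη : AnalyticAt ℂ f (z + η))
    (hzF : ∀ a ∈ F, z ≠ a) (hzηF : ∀ a ∈ F, z + η ≠ a)
    (hg : AnalyticOnNhd ℂ g (closedBall 0 R)) (hg0 : ∀ z ∈ closedBall 0 R, g z ≠ 0)
    (hR : ‖z‖ + ‖η‖ < R)
    (hfg : f =ᶠ[codiscreteWithin (closedBall 0 R)] fun z => (∏ a ∈ F, (z - a) ^ D a) * g z) :
    ∃ ρ : ℂ, f (z + η) / f z = Complex.exp (η * (deriv f z / f z) +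
        (∑ a ∈ F, D a * (Complex.log (1 + η / (z - a)) - η / (z - a)) + ρ)) ∧
      ‖ρ‖ ≤ 2 * R * ‖η‖ ^ 2 / ((R - ‖z‖) ^ 2 * (R - ‖z‖ - ‖η‖))
        * circleAverage (fun ζ => |log ‖g ζ‖|) 0 R := by
  have hzR : ‖z‖ < R := by linarith [norm_nonneg η]
  have hzηR : ‖z + η‖ < R := (norm_add_le z η).trans_lt hR
  have hz' : z ∈ closedBall (0 : ℂ) R := by simpa using hzR.le
  have hzη' : z + η ∈ closedBall (0 : ℂ) R := by simpa using hzηR.le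
  obtain ⟨ρ, hρ, hρn⟩ := exists_quotient_eq_exp_of_ne_zero hg hg0 hR
  have e₁ := eventuallyEq_nhds_factorization hz hzF (hg z hz') hzR hfg
  have e₂ := eventuallyEq_nhds_factorization hzη hzηF (hg _ hzη') hzηR hfg
  refine ⟨ρ, ?_, hρn⟩
  rw [deriv_div_factorization hzF (hg z hz') (hg0 z hz') e₁, e₁.eq_of_nhds, e₂.eq_of_nhds,
    mul_div_mul_comm, prod_quotient_eq_exp hzF hzηF, hρ, ← Complex.exp_add]
  congr 1
  ring

lemma abs_log_le_of_le {x b : ℝ} (hb : 1 ≤ b) (hx : |x| ≤ b) : |log x| ≤ 2 * log b - log x := by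
  have hlb := log_nonneg hb
  have h₁ : log x ≤ log b := by
    rcases eq_or_ne x 0 with rfl | h
    · simpa using hlb
    · rw [← log_abs x]
      exact log_le_log (abs_pos.2 h) hx
  rw [abs_le]
  constructor <;> linarith

/-- The mean of `log|z-a|` is exactly `log R`, and `|z-a| ≤ 2R` on the circle, so `abs_log_le_of_le`
gives `2 log(2R) - log R`. -/
lemma circleAverage_abs_log_norm_sub_le {a : ℂ} (hR : 1 ≤ R) (ha : ‖a‖ ≤ R) :
    circleAverage (fun z => |log ‖z - a‖|) 0 R ≤ log (4 * R) := by
  have hR0 : 0 < R := by linarith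
  have hi : CircleIntegrable (fun z : ℂ => log ‖z - a‖) 0 R := circleIntegrable_log_norm_sub_const R
  have hc : CircleIntegrable (fun _ : ℂ => 2 * log (2 * R)) 0 R := circleIntegrable_const _ _ _
  have h := circleAverage_mono (f₂ := fun z => 2 * log (2 * R) - log ‖z - a‖) hi.abs
    (hc.sub hi) (fun z hz => ?_)
  · refine h.trans_eq ?_
    rw [circleAverage_fun_sub hc hi, circleAverage_const,
      circleAverage_log_norm_sub_const_of_mem_closedBall (by simpa using ha.trans (le_abs_self R)),
      show (4 : ℝ) * R = 2 * (2 * R) by ring,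
      log_mul two_ne_zero (y := 2 * R) (by positivity), log_mul two_ne_zero hR0.ne']
    ring
  · refine abs_log_le_of_le (by linarith) ?_
    rw [abs_norm]
    rw [abs_of_pos (by linarith), mem_sphere_zero_iff_norm] at hz
    linarith [norm_sub_le z a]

lemma circleAverage_abs_log_norm (hf : Meromorphic f) :
    circleAverage (fun z => |log ‖f z‖|) 0 R = proximity f ⊤ R + proximity f⁻¹ ⊤ R := by
  have h₁ : CircleIntegrable (fun z => log⁺ ‖f z‖) 0 R :=
    hf.meromorphicOn.circleIntegrable_posLog_norm
  have h₂ : CircleIntegrable (fun z => log⁺ ‖f⁻¹ z‖) 0 R :=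
    hf.inv.meromorphicOn.circleIntegrable_posLog_norm
  rw [proximity_top, proximity_top, ← circleAverage_fun_add h₁ h₂]
  congr 1
  ext z
  rw [Pi.inv_apply, norm_inv, posLog_apply, posLog_apply, log_inv]
  rcases le_total 0 (log ‖f z‖) with h | h
  · rw [abs_of_nonneg h, max_eq_right h, max_eq_left (by linarith), add_zero]
  · rw [abs_of_nonpos h, max_eq_left h, max_eq_right (by linarith), zero_add]

lemma circleAverage_abs_log_norm_factor_le (hf : Meromorphic f) (hR : 1 ≤ R)
    (hF : ∀ a ∈ F, ‖a‖ ≤ R)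
    (hg0 : ∀ z ∈ closedBall 0 R, g z ≠ 0)
    (hfg : f =ᶠ[codiscreteWithin (closedBall 0 R)] fun z => (∏ a ∈ F, (z - a) ^ D a) * g z) :
    circleAverage (fun z => |log ‖g z‖|) 0 R
      ≤ proximity f ⊤ R + proximity f⁻¹ ⊤ R + (∑ a ∈ F, |(D a : ℝ)|) * log (4 * R) := by
  have hR0 : 0 < R := by linarith
  set u : ℂ → ℝ := fun z => log ‖f z‖ - ∑ a ∈ F, D a * log ‖z - a‖ with hu
  have hia : ∀ a, CircleIntegrable (fun z : ℂ => log ‖z - a‖) 0 R := fun a =>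
    circleIntegrable_log_norm_sub_const R
  have hif : CircleIntegrable (fun z => log ‖f z‖) 0 R :=
    hf.meromorphicOn.circleIntegrable_log_norm
  have his : CircleIntegrable (fun z => ∑ a ∈ F, (D a : ℝ) * log ‖z - a‖) 0 R :=
    CircleIntegrable.fun_sum F fun a _ => (hia a).const_mul _
  have his' : ∀ a ∈ F, CircleIntegrable (fun z => |(D a : ℝ)| * |log ‖z - a‖|) 0 R :=
    fun a _ => (hia a).abs.const_mul _
  -- Zeros and poles may lie on the circle, but circle averages ignore discrete sets.
  have hcongr : (fun z => |log ‖g z‖|) =ᶠ[codiscreteWithin (sphere 0 |R|)] fun z => |u z| := by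
    rw [abs_of_pos hR0]
    filter_upwards [hfg.filter_mono (codiscreteWithin_mono sphere_subset_closedBall),
      compl_finite_mem_codiscreteWithin (s := sphere 0 R) F.finite_toSet,
      self_mem_codiscreteWithin (sphere (0 : ℂ) R)] with z hz hzF hzR
    have hn : ∀ a ∈ F, ‖z - a‖ ≠ 0 := fun a ha => by
      rw [norm_ne_zero_iff, sub_ne_zero]
      rintro rfl
      exact hzF ha
    have hgz := norm_ne_zero_iff.2 (hg0 z (sphere_subset_closedBall hzR))
    rw [hu]
    dsimp only
    rw [hz, norm_mul, norm_prod, log_mul (Finset.prod_ne_zero_iff.2 fun a ha => by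
      rw [norm_zpow]; exact zpow_ne_zero _ (hn a ha)) hgz, log_prod fun a ha => by
      rw [norm_zpow]; exact zpow_ne_zero _ (hn a ha)]
    simp_rw [norm_zpow, log_zpow]
    rw [add_sub_cancel_left]
  rw [circleAverage_congr_codiscreteWithin hcongr hR0.ne']
  calc circleAverage (fun z => |u z|) 0 R
      ≤ circleAverage (fun z => |log ‖f z‖| + ∑ a ∈ F, |(D a : ℝ)| * |log ‖z - a‖|) 0 R := by
        refine circleAverage_mono (hif.sub his).abs (hif.abs.add (CircleIntegrable.fun_sum F his'))
          fun z _ => ?_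
        refine (abs_sub _ _).trans (add_le_add le_rfl ?_)
        exact (Finset.abs_sum_le_sum_abs _ _).trans (Finset.sum_le_sum fun a _ => (abs_mul _ _).le)
    _ = proximity f ⊤ R + proximity f⁻¹ ⊤ R +
          ∑ a ∈ F, |(D a : ℝ)| * circleAverage (fun z => |log ‖z - a‖|) 0 R := by
        rw [circleAverage_fun_add (f₁ := fun z => |log ‖f z‖|) hif.abs (CircleIntegrable.fun_sum F his'),
          circleAverage_abs_log_norm hf, circleAverage_fun_sum his']
        simp_rw [← smul_eq_mul, circleAverage_fun_smul]
    _ ≤ _ := by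
        rw [Finset.sum_mul]
        gcongr with a ha
        exact circleAverage_abs_log_norm_sub_le hR (hF a ha)

end Factorization

/-! ### Logarithmic measure of unions and countable sets. -/

section LogMeasure

lemma logMeasure_union_le (A B : Set ℝ) : logMeasure (A ∪ B) ≤ logMeasure A + logMeasure B := by
  rw [logMeasure, union_inter_distrib_right]
  exact lintegral_union_le _ _ _

lemma logMeasure_of_countable {A : Set ℝ} (hA : A.Countable) : logMeasure A = 0 :=
  setLIntegral_measure_zero _ _ ((hA.mono inter_subset_left).measure_zero _)

end LogMeasure

/-! ### Growth of the characteristic, the divisor and the zero-free factor. -/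

section Counting

open Real ValueDistribution MeromorphicOn Metric

variable {f : ℂ → ℂ} {σ : ℝ}

lemma exists_characteristic_inv_le (hf : Meromorphic f) :
    ∃ C : ℝ, 0 ≤ C ∧ ∀ r, characteristic f⁻¹ ⊤ r ≤ characteristic f ⊤ r + C :=
  ⟨_, (abs_nonneg _).trans (le_max_left _ _), fun r => by
    linarith [(abs_le.1 (characteristic_sub_characteristic_inv_le hf (R := r))).1]⟩

lemma exists_eventually_characteristic_le (hf : Meromorphic f) (hσ : order f = (σ : EReal)) {δ : ℝ}
    (hδ : 0 < δ) : ∃ K : ℝ, 0 ≤ K ∧ ∀ᶠ r in atTop,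
      characteristic f ⊤ r ≤ K * r ^ (σ + δ) ∧ characteristic f⁻¹ ⊤ r ≤ K * r ^ (σ + δ) := by
  obtain ⟨C, hC, hinv⟩ := exists_characteristic_inv_le hf
  refine ⟨1 + C, by linarith, ?_⟩
  filter_upwards [eventually_characteristic_le_rpow hσ hδ, eventually_ge_atTop 1] with r hr hr1
  have h₁ : 1 ≤ r ^ (σ + δ) := one_le_rpow hr1 (by linarith [order_nonneg hσ])
  constructor <;> nlinarith [hinv r]

lemma exponentOfConvergence_lt_top (hf : Meromorphic f) (hσ : order f = (σ : EReal)) :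
    zerosExponent f < ⊤ ∧ polesExponent f < ⊤ := by
  obtain ⟨K, hK, h⟩ := exists_eventually_characteristic_le hf hσ one_pos
  have hσ0 := order_nonneg hσ
  have key : ∀ D : Function.locallyFinsupp ℂ ℤ, 0 ≤ D →
      (∀ᶠ r in atTop, Function.locallyFinsuppWithin.logCounting D r ≤ K * r ^ (σ + 1)) →
      exponentOfConvergence D < ⊤ := fun D hD hN =>
    (exponentOfConvergence_le hD (by linarith)
      (summable_of_logCounting_le hD hK (by linarith) hN)).trans_lt (EReal.coe_lt_top _)
  refine ⟨key _ (posPart_nonneg _) ?_, key _ (negPart_nonneg _) ?_⟩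
  · filter_upwards [h] with r hr
    rw [← logCounting_zero, ← logCounting_inv]
    exact (le_add_of_nonneg_left (proximity_nonneg r)).trans hr.2
  · filter_upwards [h] with r hr
    rw [← logCounting_top]
    exact (le_add_of_nonneg_left (proximity_nonneg r)).trans hr.1

lemma exponentOfConvergence_nonneg (D : Function.locallyFinsupp ℂ ℤ) :
    0 ≤ exponentOfConvergence D := by
  refine le_sInf ?_
  rintro _ ⟨τ, ⟨hτ, _⟩, rfl⟩
  exact EReal.coe_nonneg.2 hτ.le

lemma summable_natAbs_divisor (hf : Meromorphic f) (hσ : order f = (σ : EReal)) {τ : ℝ}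
    (hτ : (max (zerosExponent f) (polesExponent f)).toReal < τ) :
    Summable fun a : ℂ => ((divisor f univ a).natAbs : ℝ) * (1 + ‖a‖) ^ (-τ) := by
  obtain ⟨hz, hp⟩ := exponentOfConvergence_lt_top hf hσ
  have htop : max (zerosExponent f) (polesExponent f) ≠ ⊤ := (max_lt hz hp).ne
  have hbot : max (zerosExponent f) (polesExponent f) ≠ ⊥ := by
    intro h
    have := (exponentOfConvergence_nonneg _).trans (le_max_left (zerosExponent f) (polesExponent f))
    simp [h] at this
  have hlt : max (zerosExponent f) (polesExponent f) < (τ : EReal) := by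
    rw [← EReal.coe_toReal htop hbot]
    exact_mod_cast hτ
  have h₁ := summable_of_exponentOfConvergence_lt (posPart_nonneg _) ((le_max_left _ _).trans_lt hlt)
  have h₂ := summable_of_exponentOfConvergence_lt (negPart_nonneg _) ((le_max_right _ _).trans_lt hlt)
  refine (h₁.add h₂).congr fun a => ?_
  rw [← add_mul, Function.locallyFinsuppWithin.posPart_apply,
    Function.locallyFinsuppWithin.negPart_apply, ← Int.cast_add, posPart_add_negPart,
    Nat.cast_natAbs]

lemma sum_le_of_summable {m : ℂ → ℝ} (hm : ∀ a, 0 ≤ m a) {τ R : ℝ} (hτ : 0 ≤ τ) (hR : 0 ≤ R)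
    (hsum : Summable fun a : ℂ => m a * (1 + ‖a‖) ^ (-τ)) {F : Finset ℂ} (hF : ∀ a ∈ F, ‖a‖ ≤ R) :
    ∑ a ∈ F, m a ≤ (∑' a, m a * (1 + ‖a‖) ^ (-τ)) * (1 + R) ^ τ := by
  calc ∑ a ∈ F, m a ≤ ∑ a ∈ F, m a * (1 + ‖a‖) ^ (-τ) * (1 + R) ^ τ := by
        refine Finset.sum_le_sum fun a ha => ?_
        rw [mul_assoc]
        refine le_mul_of_one_le_right (hm a) ?_
        rw [rpow_neg (by positivity), inv_mul_eq_div, one_le_div (by positivity)]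
        exact rpow_le_rpow (by positivity) (by linarith [hF a ha]) hτ
    _ ≤ _ := by
        rw [← Finset.sum_mul]
        gcongr
        exact hsum.sum_le_tsum _ fun a _ => mul_nonneg (hm a) (by positivity)

/-- Growth of the zero-free factor of a meromorphic function on large disks. -/
lemma exists_circleAverage_factor_le (hf : Meromorphic f) (hσ : order f = (σ : EReal)) {ε : ℝ}
    (hε : 0 < ε) :
    ∃ K : ℝ, 0 ≤ K ∧ ∀ᶠ R in atTop, ∀ (F : Finset ℂ) (g : ℂ → ℂ), (∀ a ∈ F, ‖a‖ ≤ R) →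
      (∀ z ∈ closedBall (0 : ℂ) R, g z ≠ 0) →
      f =ᶠ[codiscreteWithin (closedBall 0 R)]
        (fun z => (∏ a ∈ F, (z - a) ^ divisor f univ a) * g z) →
      circleAverage (fun z => |log ‖g z‖|) 0 R ≤ K * (R ^ (σ + ε) +
        R ^ ((max (zerosExponent f) (polesExponent f)).toReal + ε)) := by
  set lam := (max (zerosExponent f) (polesExponent f)).toReal with hlam
  have hlam0 : 0 ≤ lam := EReal.toReal_nonneg (le_max_of_le_left (exponentOfConvergence_nonneg _))
  obtain ⟨K, hK, hchar⟩ := exists_eventually_characteristic_le hf hσ hε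
  -- One half of `ε` goes to the count of zeros and poles, the other absorbs the factor `log(4R)`.
  have hsum := summable_natAbs_divisor hf hσ (τ := lam + ε / 2) (by rw [← hlam]; linarith)
  set C := ∑' a : ℂ, ((divisor f univ a).natAbs : ℝ) * (1 + ‖a‖) ^ (-(lam + ε / 2)) with hC
  have hC0 : 0 ≤ C := tsum_nonneg fun a => by positivity
  set B : ℝ := C * 2 ^ (lam + ε / 2) * (4 ^ (ε / 2) / (ε / 2)) with hB
  have hB0 : 0 ≤ B := by positivity
  refine ⟨2 * K + B, by positivity, ?_⟩
  filter_upwards [hchar, eventually_ge_atTop 1] with R hR hR1 F g hF hg0 hfg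
  have hR0 : 0 < R := by linarith
  have h₁ := circleAverage_abs_log_norm_factor_le hf hR1 hF hg0 hfg
  have h₂ : proximity f ⊤ R ≤ characteristic f ⊤ R :=
    le_add_of_nonneg_right (logCounting_nonneg hR1)
  have h₃ : proximity f⁻¹ ⊤ R ≤ characteristic f⁻¹ ⊤ R :=
    le_add_of_nonneg_right (logCounting_nonneg hR1)
  have h₄ : ∑ a ∈ F, |(divisor f univ a : ℝ)| ≤ C * (2 ^ (lam + ε / 2) * R ^ (lam + ε / 2)) := by
    have := sum_le_of_summable (fun a => Nat.cast_nonneg _) (by linarith) hR0.le hsum hF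
    simp only [Nat.cast_natAbs, Int.cast_abs] at this
    refine this.trans ?_
    rw [← mul_rpow (by norm_num) hR0.le]
    simp only [hC, Nat.cast_natAbs, Int.cast_abs]
    gcongr
    linarith
  have h₅ : log (4 * R) ≤ 4 ^ (ε / 2) / (ε / 2) * R ^ (ε / 2) := by
    have := log_le_rpow_div (by positivity : 0 ≤ 4 * R) (half_pos hε)
    rwa [mul_rpow (by norm_num) hR0.le, mul_div_right_comm] at this
  have h₆ : (∑ a ∈ F, |(divisor f univ a : ℝ)|) * log (4 * R) ≤ B * R ^ (lam + ε) := by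
    calc _ ≤ C * (2 ^ (lam + ε / 2) * R ^ (lam + ε / 2)) *
          (4 ^ (ε / 2) / (ε / 2) * R ^ (ε / 2)) :=
        mul_le_mul h₄ h₅ (log_nonneg (by linarith)) (by positivity)
      _ = B * R ^ (lam + ε) := by
        rw [hB, show lam + ε = lam + ε / 2 + ε / 2 by ring, rpow_add hR0 (lam + ε / 2)]
        ring
  have h₇ : 0 ≤ R ^ (σ + ε) := by positivity
  have h₈ : 0 ≤ R ^ (lam + ε) := by positivity
  have h₉ : 0 ≤ B * R ^ (σ + ε) := by positivity
  have h₁₀ : 0 ≤ K * R ^ (lam + ε) := by positivity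
  linarith [hR.1, hR.2]

end Counting

/-! ### The sum over zeros and poles, and the exponent `β`. -/

section Assembly

open Real ValueDistribution MeromorphicOn Metric

lemma sum_mul_sq_le {ι : Type*} (F : Finset ι) (m : ι → ℕ) {x : ι → ℝ} (hx : ∀ i, 0 ≤ x i) :
    ∑ i ∈ F, (m i : ℝ) * x i ^ 2 ≤ (∑ i ∈ F, (m i : ℝ) * x i) ^ 2 := by
  refine le_trans (Finset.sum_le_sum fun i _ => ?_)
    (Finset.sum_sq_le_sq_sum_of_nonneg fun i _ => mul_nonneg (Nat.cast_nonneg (m i)) (hx i))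
  rw [mul_pow]
  gcongr
  exact_mod_cast Nat.le_self_pow two_ne_zero (m i)

lemma norm_div_sub_le {η z a : ℂ} (h : ‖z‖ ≠ ‖a‖) : ‖η / (z - a)‖ ≤ ‖η‖ * |‖z‖ - ‖a‖|⁻¹ := by
  rw [norm_div, div_eq_mul_inv]
  have := abs_pos.2 (sub_ne_zero.2 h)
  gcongr
  exact abs_norm_sub_norm_le z a

/-- With `w = η/(z-a)` one has `w/(1+w) = η/(z-(a-η))`, which is why the translates `a - η` enter.
The two conclusions come from the linear and the quadratic bound for `log(1+w) - w`. -/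
lemma norm_sum_log_sub_le {F : Finset ℂ} {D : ℂ → ℤ} {z η : ℂ} {s : ℝ}
    (h₁ : ∀ a ∈ F, ‖z‖ ≠ ‖a‖) (h₂ : ∀ a ∈ F, ‖z‖ ≠ ‖a - η‖)
    (hs₁ : ∑ a ∈ F, ((D a).natAbs : ℝ) * |‖z‖ - ‖a‖|⁻¹ ≤ s)
    (hs₂ : ∑ a ∈ F, ((D a).natAbs : ℝ) * |‖z‖ - ‖a - η‖|⁻¹ ≤ s) :
    ‖∑ a ∈ F, D a * (Complex.log (1 + η / (z - a)) - η / (z - a))‖ ≤ 20 * ‖η‖ * s ∧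
    ‖∑ a ∈ F, D a * (Complex.log (1 + η / (z - a)) - η / (z - a))‖ ≤ 50 * ‖η‖ ^ 2 * s ^ 2 := by
  have hnorm : ‖∑ a ∈ F, D a * (Complex.log (1 + η / (z - a)) - η / (z - a))‖ ≤
      ∑ a ∈ F, ((D a).natAbs : ℝ) * ‖Complex.log (1 + η / (z - a)) - η / (z - a)‖ := by
    refine (norm_sum_le _ _).trans (Finset.sum_le_sum fun a _ => ?_)
    rw [norm_mul, Complex.norm_intCast, Nat.cast_natAbs, Int.cast_abs]
  have hne : ∀ a ∈ F, 1 + η / (z - a) ≠ 0 ∧ η / (z - a) / (1 + η / (z - a)) = η / (z - (a - η)) :=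
    fun a ha => by
      have e₁ : z - a ≠ 0 := sub_ne_zero.2 fun h => h₁ a ha (by rw [h])
      have e₂ : z - (a - η) ≠ 0 := sub_ne_zero.2 fun h => h₂ a ha (by rw [← h])
      have e₃ : 1 + η / (z - a) = (z - (a - η)) / (z - a) := by field_simp; ring
      rw [e₃]
      exact ⟨div_ne_zero e₂ e₁, by field_simp⟩
  have hx : ∀ a ∈ F, ‖η / (z - a)‖ ≤ ‖η‖ * |‖z‖ - ‖a‖|⁻¹ := fun a ha => norm_div_sub_le (h₁ a ha)
  have hy : ∀ a ∈ F, ‖η / (z - a) / (1 + η / (z - a))‖ ≤ ‖η‖ * |‖z‖ - ‖a - η‖|⁻¹ := fun a ha => by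
    rw [(hne a ha).2]
    exact norm_div_sub_le (h₂ a ha)
  constructor
  · calc _ ≤ ∑ a ∈ F, ((D a).natAbs : ℝ) * (10 * (‖η‖ * |‖z‖ - ‖a‖|⁻¹ + ‖η‖ * |‖z‖ - ‖a - η‖|⁻¹)) := by
          refine hnorm.trans (Finset.sum_le_sum fun a ha => ?_)
          gcongr
          refine (norm_log_one_add_sub_le (hne a ha).1).trans ?_
          linarith [hx a ha, hy a ha]
      _ = 10 * ‖η‖ * (∑ a ∈ F, ((D a).natAbs : ℝ) * |‖z‖ - ‖a‖|⁻¹ +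
            ∑ a ∈ F, ((D a).natAbs : ℝ) * |‖z‖ - ‖a - η‖|⁻¹) := by
          rw [← Finset.sum_add_distrib, Finset.mul_sum]
          exact Finset.sum_congr rfl fun a _ => by ring
      _ ≤ 10 * ‖η‖ * (s + s) := by gcongr
      _ = _ := by ring
  · have hsq : ∀ {x : ℂ → ℝ}, (∀ a, 0 ≤ x a) → ∑ a ∈ F, ((D a).natAbs : ℝ) * x a ≤ s →
        ∑ a ∈ F, ((D a).natAbs : ℝ) * x a ^ 2 ≤ s ^ 2 := fun hx h =>
      (sum_mul_sq_le F _ hx).trans (pow_le_pow_left₀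
        (Finset.sum_nonneg fun a _ => mul_nonneg (Nat.cast_nonneg _) (hx a)) h 2)
    calc _ ≤ ∑ a ∈ F, ((D a).natAbs : ℝ) *
          (25 * ((‖η‖ * |‖z‖ - ‖a‖|⁻¹) ^ 2 + (‖η‖ * |‖z‖ - ‖a - η‖|⁻¹) ^ 2)) := by
          refine hnorm.trans (Finset.sum_le_sum fun a ha => ?_)
          gcongr
          refine (norm_log_one_add_sub_le_sq (hne a ha).1).trans ?_
          gcongr
          · exact hx a ha
          · exact hy a ha
      _ = 25 * ‖η‖ ^ 2 * (∑ a ∈ F, ((D a).natAbs : ℝ) * |‖z‖ - ‖a‖|⁻¹ ^ 2 +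
            ∑ a ∈ F, ((D a).natAbs : ℝ) * |‖z‖ - ‖a - η‖|⁻¹ ^ 2) := by
          rw [← Finset.sum_add_distrib, Finset.mul_sum]
          exact Finset.sum_congr rfl fun a _ => by ring
      _ ≤ 25 * ‖η‖ ^ 2 * (s ^ 2 + s ^ 2) := by
          gcongr
          · exact hsq (fun a => by positivity) hs₁
          · exact hsq (fun a => by positivity) hs₂
      _ = _ := by ring

lemma sub_two_le_beta (σ lam : ℝ) : σ - 2 ≤ beta σ lam := by
  rw [beta]
  split_ifs
  · exact le_max_left _ _
  · exact le_max_left _ _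

lemma exponent_sub_two_le_beta (σ : ℝ) {lam : ℝ} (h : 0 ≤ lam) : lam - 2 ≤ beta σ lam := by
  rw [beta]
  split_ifs
  · exact le_max_of_le_right (by linarith)
  · exact le_max_of_le_right (by linarith)

/-- The sum over zeros and poles has the growth `r ^ (beta + ε)`: the linear estimate of its terms is
used if the exponent of convergence is at least `1`, the quadratic one otherwise. -/
lemma exists_norm_sum_log_le {D : ℂ → ℤ} {η : ℂ} (σ : ℝ) {lam ε : ℝ} :
    ∃ K : ℝ, 0 ≤ K ∧ ∀ (F : Finset ℂ) (z : ℂ), 1 ≤ ‖z‖ → (∀ a ∈ F, ‖z‖ ≠ ‖a‖) →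
      (∀ a ∈ F, ‖z‖ ≠ ‖a - η‖) →
      ∑ a ∈ F, ((D a).natAbs : ℝ) * |‖z‖ - ‖a‖|⁻¹ ≤ ‖z‖ ^ (lam + ε / 2 - 1) →
      ∑ a ∈ F, ((D a).natAbs : ℝ) * |‖z‖ - ‖a - η‖|⁻¹ ≤ ‖z‖ ^ (lam + ε / 2 - 1) → 0 < ε →
      ‖∑ a ∈ F, D a * (Complex.log (1 + η / (z - a)) - η / (z - a))‖ ≤ K * ‖z‖ ^ (beta σ lam + ε) := by
  refine ⟨20 * ‖η‖ + 50 * ‖η‖ ^ 2, by positivity, fun F z hz h₁ h₂ hs₁ hs₂ hε => ?_⟩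
  obtain ⟨hl, hq⟩ := norm_sum_log_sub_le h₁ h₂ hs₁ hs₂
  have hp : 0 ≤ ‖z‖ ^ (beta σ lam + ε) := by positivity
  rcases lt_or_ge lam 1 with h | h
  · have : (‖z‖ ^ (lam + ε / 2 - 1)) ^ 2 ≤ ‖z‖ ^ (beta σ lam + ε) := by
      rw [← rpow_mul_natCast (norm_nonneg z)]
      refine rpow_le_rpow_of_exponent_le hz ?_
      rw [beta, if_pos h]
      have := le_max_right (σ - 2) (2 * lam - 2)
      push_cast
      linarith
    refine hq.trans ?_
    rw [add_mul]
    exact le_add_of_nonneg_of_le (by positivity) (by gcongr)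
  · have : ‖z‖ ^ (lam + ε / 2 - 1) ≤ ‖z‖ ^ (beta σ lam + ε) := by
      refine rpow_le_rpow_of_exponent_le hz ?_
      rw [beta, if_neg (not_lt.2 h)]
      have := le_max_right (σ - 2) (lam - 1)
      linarith
    refine hl.trans ?_
    rw [add_mul]
    exact le_add_of_le_of_nonneg (by gcongr) (by positivity)

end Assembly

/-! ### The difference quotient off the exceptional set. -/

section DifferenceQuotient

open Real ValueDistribution MeromorphicOn Metric

/-- Outside a set of finite logarithmic measure, the sums of the reciprocal distances of `|z|` to the
moduli of the zeros and poles, and of their translates by `-η`, are small. -/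
lemma exists_exceptional_divisor {f : ℂ → ℂ} {σ : ℝ} (hf : Meromorphic f)
    (hord : ∀ z, meromorphicOrderAt f z ≠ ⊤) (hσ : order f = (σ : EReal)) (η : ℂ) {ε : ℝ}
    (hε : 0 < ε) :
    ∃ E : Set ℝ, E ⊆ Ioi 1 ∧ MeasurableSet E ∧ logMeasure E < ⊤ ∧
      (∀ z : ℂ, ‖z‖ ∉ E ∪ Icc 0 1 →
        AnalyticAt ℂ f z ∧ f z ≠ 0 ∧ AnalyticAt ℂ f (z + η) ∧ f (z + η) ≠ 0) ∧
      ∀ z : ℂ, ‖z‖ ∉ E ∪ Icc 0 1 → ‖η‖ ≤ ‖z‖ →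
        ∀ F : Finset ℂ, (∀ a ∈ F, ‖a‖ ≤ 3 * ‖z‖ ∧ divisor f univ a ≠ 0) →
          (∀ a ∈ F, ‖z‖ ≠ ‖a‖ ∧ ‖z‖ ≠ ‖a - η‖) ∧
          ∑ a ∈ F, ((divisor f univ a).natAbs : ℝ) * |‖z‖ - ‖a‖|⁻¹ ≤
            ‖z‖ ^ ((max (zerosExponent f) (polesExponent f)).toReal + ε - 1) ∧
          ∑ a ∈ F, ((divisor f univ a).natAbs : ℝ) * |‖z‖ - ‖a - η‖|⁻¹ ≤
            ‖z‖ ^ ((max (zerosExponent f) (polesExponent f)).toReal + ε - 1) := by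
  set lam := (max (zerosExponent f) (polesExponent f)).toReal with hlam
  have hlam0 : 0 ≤ lam := EReal.toReal_nonneg (le_max_of_le_left (exponentOfConvergence_nonneg _))
  -- Chosen so that `τ > λ`, `p < 1` and `τ/p = λ + ε`.
  set τ := lam + ε / 2 with hτ
  set p := τ / (lam + ε) with hp
  have hτ0 : 0 < τ := by linarith
  have hp0 : 0 < p := by positivity
  have hp1 : p < 1 := by rw [hp, div_lt_one (by linarith)]; linarith
  have hτp : τ / p = lam + ε := by rw [hp]; field_simp
  have hsum := summable_natAbs_divisor hf hσ (τ := τ) (by rw [← hlam]; linarith)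
  set B := {z | AnalyticAt ℂ f z ∧ f z ≠ 0}ᶜ with hB
  have hBc : B.Countable := countable_compl_regular hf hord
  have hDB : ∀ a, divisor f univ a ≠ 0 → a ∈ B := fun a ha h =>
    ha (divisor_eq_zero_of_regular hf h.1 h.2)
  have hDc : (fun a => (divisor f univ a).natAbs).support.Countable :=
    hBc.mono fun a ha => hDB a (Int.natAbs_ne_zero.1 ha)
  have hsum' : Summable fun a : ℂ => ((divisor f univ a).natAbs : ℝ) * (1 + ‖a - η‖) ^ (-τ) := by
    refine Summable.of_nonneg_of_le (fun a => by positivity) (fun a => ?_)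
      (hsum.mul_left ((1 + ‖η‖) ^ τ))
    rw [mul_left_comm]
    gcongr
    rw [rpow_neg (by positivity), rpow_neg (by positivity), ← div_eq_mul_inv,
      le_div_iff₀ (by positivity), inv_mul_le_iff₀ (by positivity),
      ← mul_rpow (by positivity) (by positivity)]
    have h₁ : ‖a‖ ≤ ‖a - η‖ + ‖η‖ := by simpa using norm_add_le (a - η) η
    have h₂ : 0 ≤ ‖a - η‖ * ‖η‖ := by positivity
    gcongr
    nlinarith
  obtain ⟨E₁, hE₁, hm₁, hl₁, hs₁⟩ := exists_exceptional_inv hDc (t := fun a => ‖a‖)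
    (fun a => norm_nonneg a) hp0 hp1 hτ0 hsum
  obtain ⟨E₂, hE₂, hm₂, hl₂, hs₂⟩ := exists_exceptional_inv hDc (t := fun a => ‖a - η‖)
    (fun a => norm_nonneg _) hp0 hp1 hτ0 hsum'
  -- Since `0⁻¹ = 0`, the sums do not detect a radius equal to some `|a|` or `|a-η|`; these
  -- countably many radii are removed separately.
  set N : Set ℝ := ((fun a : ℂ => ‖a‖) '' B ∪ (fun a : ℂ => ‖a - η‖) '' B) ∩ Ioi 1 with hN
  have hNc : N.Countable := ((hBc.image _).union (hBc.image _)).mono inter_subset_left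
  have hmem : ∀ {z : ℂ}, ‖z‖ ∉ (E₁ ∪ E₂ ∪ N) ∪ Icc 0 1 →
      1 < ‖z‖ ∧ ‖z‖ ∉ E₁ ∧ ‖z‖ ∉ E₂ ∧ ∀ a ∈ B, ‖z‖ ≠ ‖a‖ ∧ ‖z‖ ≠ ‖a - η‖ := fun {z} hz => by
    have h1 : 1 < ‖z‖ := by
      by_contra h
      exact hz (Or.inr ⟨norm_nonneg z, not_lt.1 h⟩)
    refine ⟨h1, fun h => hz (Or.inl (Or.inl (Or.inl h))), fun h => hz (Or.inl (Or.inl (Or.inr h))),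
      fun a ha => ⟨fun h => ?_, fun h => ?_⟩⟩
    · exact hz (Or.inl (Or.inr ⟨Or.inl ⟨a, ha, h.symm⟩, h1⟩))
    · exact hz (Or.inl (Or.inr ⟨Or.inr ⟨a, ha, h.symm⟩, h1⟩))
  refine ⟨E₁ ∪ E₂ ∪ N, union_subset (union_subset hE₁ hE₂) inter_subset_right,
    (hm₁.union hm₂).union hNc.measurableSet, ?_, fun z hz => ?_, fun z hz hηz F hF => ?_⟩
  · calc logMeasure (E₁ ∪ E₂ ∪ N) ≤ logMeasure E₁ + logMeasure E₂ + 0 := by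
          rw [← logMeasure_of_countable hNc]
          exact (logMeasure_union_le _ _).trans (add_le_add_left (logMeasure_union_le _ _) _)
      _ < ⊤ := by simp [hl₁, hl₂]
  · obtain ⟨-, -, -, hb⟩ := hmem hz
    have h₁ : z ∉ B := fun h => (hb z h).1 rfl
    have h₂ : z + η ∉ B := fun h => (hb _ h).2 (by simp)
    rw [hB, notMem_compl_iff] at h₁ h₂
    exact ⟨h₁.1, h₁.2, h₂.1, h₂.2⟩
  · obtain ⟨h1, hz₁, hz₂, hb⟩ := hmem hz
    rw [hτp] at hs₁ hs₂
    refine ⟨fun a ha => hb a (hDB a (hF a ha).2), hs₁ _ h1 hz₁ F fun a ha => ?_,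
      hs₂ _ h1 hz₂ F fun a ha => ?_⟩
    · linarith [(hF a ha).1]
    · linarith [(hF a ha).1, norm_sub_le a η]

/-- The difference quotient of a meromorphic function of finite order, off an exceptional set. -/
lemma exists_exceptional_quotient {f : ℂ → ℂ} {σ : ℝ} (hf : Meromorphic f)
    (hf0 : ¬ f =ᶠ[codiscrete ℂ] 0) (hσ : order f = (σ : EReal)) (η : ℂ) {ε : ℝ} (hε : 0 < ε) :
    ∃ E : Set ℝ, E ⊆ Ioi 1 ∧ MeasurableSet E ∧ logMeasure E < ⊤ ∧
      (∀ z : ℂ, ‖z‖ ∉ E ∪ Icc 0 1 →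
        AnalyticAt ℂ f z ∧ f z ≠ 0 ∧ AnalyticAt ℂ f (z + η) ∧ f (z + η) ≠ 0) ∧
      ∃ r₀ > 0, ∃ K > 0, ∀ z : ℂ, ‖z‖ ∉ E ∪ Icc 0 1 → r₀ < ‖z‖ →
        ∃ ρ : ℂ, f (z + η) / f z = Complex.exp (η * (deriv f z / f z) + ρ) ∧
          ‖ρ‖ ≤ K * ‖z‖ ^ (beta σ (max (zerosExponent f) (polesExponent f)).toReal + ε) := by
  have hord := meromorphicOrderAt_ne_top_of_not_eventually_zero hf hf0
  obtain ⟨E, hE, hEm, hEl, hreg, hdiv⟩ := exists_exceptional_divisor hf hord hσ η (half_pos hε)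
  obtain ⟨K₁, hK₁, hgrowth⟩ := exists_circleAverage_factor_le hf hσ hε
  set lam := (max (zerosExponent f) (polesExponent f)).toReal with hlam
  have hlam0 : 0 ≤ lam := EReal.toReal_nonneg (le_max_of_le_left (exponentOfConvergence_nonneg _))
  obtain ⟨K₂, hK₂, hsum⟩ := exists_norm_sum_log_le (D := divisor f univ) (η := η) σ
    (lam := lam) (ε := ε)
  obtain ⟨R₀, hR₀⟩ := eventually_atTop.1 hgrowth
  set K₃ := 3 / 2 * ‖η‖ ^ 2 * (K₁ * (3 ^ (σ + ε) + 3 ^ (lam + ε))) with hK₃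
  refine ⟨E, hE, hEm, hEl, hreg, max 1 (max ‖η‖ R₀), by positivity, K₂ + K₃ + 1, by positivity,
    fun z hz hr => ?_⟩
  simp only [max_lt_iff] at hr
  obtain ⟨hr1, hrη, hrR⟩ := hr
  have hr0 : 0 < ‖z‖ := by linarith
  -- With `R = 3|z|` and `|η| < |z|`, both `z` and `z + η` stay at distance at least `|z|` from the
  -- circle, so the kernel factor is `O(|z|^(-2))`. The points satisfy `|a|, |a-η| ≤ 4|z|`, as the
  -- exceptional-set estimate requires.
  obtain ⟨F, g, hF, hg, hg0, hfg⟩ := exists_factorization hf hord (3 * ‖z‖)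
  obtain ⟨hne, hs₁, hs₂⟩ := hdiv z hz hrη.le F hF
  obtain ⟨hz₁, -, hz₂, -⟩ := hreg z hz
  obtain ⟨ρ, hρ, hρn⟩ := exists_quotient_eq_exp hz₁ hz₂
    (fun a ha h => (hne a ha).1 (by rw [h]))
    (fun a ha h => (hne a ha).2 (by rw [← h, add_sub_cancel_right])) hg hg0
    (by linarith : ‖z‖ + ‖η‖ < 3 * ‖z‖) hfg
  refine ⟨_, hρ, ?_⟩
  have hb := hsum F z hr1.le (fun a ha => (hne a ha).1) (fun a ha => (hne a ha).2) hs₁ hs₂ hε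
  have hc := hR₀ (3 * ‖z‖) (by linarith) F g (fun a ha => (hF a ha).1) hg0 hfg
  have hkernel : 2 * (3 * ‖z‖) * ‖η‖ ^ 2 / ((3 * ‖z‖ - ‖z‖) ^ 2 * (3 * ‖z‖ - ‖z‖ - ‖η‖))
      ≤ 3 / 2 * ‖η‖ ^ 2 * ‖z‖ ^ (-2 : ℝ) := by
    rw [rpow_neg hr0.le, rpow_two, div_le_iff₀ (mul_pos (by nlinarith) (by linarith))]
    have : 3 / 2 * ‖η‖ ^ 2 * (‖z‖ ^ 2)⁻¹ * ((3 * ‖z‖ - ‖z‖) ^ 2 * (3 * ‖z‖ - ‖z‖ - ‖η‖))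
        = 6 * ‖η‖ ^ 2 * (2 * ‖z‖ - ‖η‖) := by
      field_simp
      ring
    rw [this]
    nlinarith [sq_nonneg ‖η‖]
  have hpow : ∀ s, s - 2 ≤ beta σ lam →
      ‖z‖ ^ (-2 : ℝ) * (3 * ‖z‖) ^ (s + ε) ≤ 3 ^ (s + ε) * ‖z‖ ^ (beta σ lam + ε) := fun s hs => by
    rw [mul_rpow (by norm_num) hr0.le, mul_left_comm, ← rpow_add hr0]
    exact mul_le_mul_of_nonneg_left (rpow_le_rpow_of_exponent_le hr1.le (by linarith))
      (by positivity)
  have hρ' : ‖ρ‖ ≤ K₃ * ‖z‖ ^ (beta σ lam + ε) := by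
    calc ‖ρ‖ ≤ 3 / 2 * ‖η‖ ^ 2 * ‖z‖ ^ (-2 : ℝ) *
          (K₁ * ((3 * ‖z‖) ^ (σ + ε) + (3 * ‖z‖) ^ (lam + ε))) :=
          hρn.trans (mul_le_mul hkernel hc
            (circleAverage_nonneg_of_nonneg fun _ _ => abs_nonneg _) (by positivity))
      _ = 3 / 2 * ‖η‖ ^ 2 * (K₁ * (‖z‖ ^ (-2 : ℝ) * (3 * ‖z‖) ^ (σ + ε) +
            ‖z‖ ^ (-2 : ℝ) * (3 * ‖z‖) ^ (lam + ε))) := by ring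
      _ ≤ 3 / 2 * ‖η‖ ^ 2 * (K₁ * (3 ^ (σ + ε) * ‖z‖ ^ (beta σ lam + ε) +
            3 ^ (lam + ε) * ‖z‖ ^ (beta σ lam + ε))) := by
          exact mul_le_mul_of_nonneg_left (mul_le_mul_of_nonneg_left
            (add_le_add (hpow σ (sub_two_le_beta σ lam))
              (hpow lam (exponent_sub_two_le_beta σ hlam0))) (by positivity)) (by positivity)
      _ = _ := by rw [hK₃]; ring
  refine (norm_add_le _ _).trans ?_
  have : 0 ≤ ‖z‖ ^ (beta σ lam + ε) := by positivity
  linarith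

end DifferenceQuotient

end MeromorphicGrowth

/-- A meromorphic function is represented by `f : ℂ → ℂ` with arbitrary values on a discrete set
(such as its poles), so "not identically zero" is read up to a discrete set, and the conclusion
says that, off the exceptional radii, `f` is regular and nonzero at `z` and at `z + η`. The
exponents of convergence of a function of finite order are finite, so `toReal` loses nothing. -/
theorem theorem2p1 (f : ℂ → ℂ) (hf : Meromorphic f) (hf0 : ¬ f =ᶠ[codiscrete ℂ] 0)
    (σ : ℝ) (hσ : MeromorphicGrowth.order f = (σ : EReal))
    (η : ℂ) (hη : η ≠ 0) (ε : ℝ) (hε : 0 < ε) :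
    ∃ E : Set ℝ, E ⊆ Ioi 1 ∧ MeasurableSet E ∧ MeromorphicGrowth.logMeasure E < ⊤ ∧
      (∀ z : ℂ, ‖z‖ ∉ E ∪ Icc 0 1 →
        AnalyticAt ℂ f z ∧ f z ≠ 0 ∧ AnalyticAt ℂ f (z + η) ∧ f (z + η) ≠ 0) ∧
      (∃ (n : ℂ → ℤ) (R : ℂ → ℂ),
        MeromorphicGrowth.IsBigOModulus R (fun r => r ^ (MeromorphicGrowth.beta σ
          (max (MeromorphicGrowth.zerosExponent f) (MeromorphicGrowth.polesExponent f)).toReal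
            + ε)) ∧
        ∀ z : ℂ, ‖z‖ ∉ E ∪ Icc 0 1 →
          2 * Real.pi * Complex.I * (n z : ℂ) + Complex.log (f (z + η) / f z)
            = η * (deriv f z / f z) + R z) ∧
      (∃ R : ℂ → ℂ,
        MeromorphicGrowth.IsBigOModulus R (fun r => r ^ (MeromorphicGrowth.beta σ
          (max (MeromorphicGrowth.zerosExponent f) (MeromorphicGrowth.polesExponent f)).toReal
            + ε)) ∧
        ∀ z : ℂ, ‖z‖ ∉ E ∪ Icc 0 1 →
          f (z + η) / f z = Complex.exp (η * (deriv f z / f z) + R z)) := by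
  classical
  obtain ⟨E, hE, hEm, hEl, hreg, r₀, hr₀, K, hK, hquot⟩ :=
    MeromorphicGrowth.exists_exceptional_quotient hf hf0 hσ η hε
  set b := MeromorphicGrowth.beta σ
    (max (MeromorphicGrowth.zerosExponent f) (MeromorphicGrowth.polesExponent f)).toReal + ε with hb
  obtain ⟨R, hRO, hR⟩ : ∃ R : ℂ → ℂ, MeromorphicGrowth.IsBigOModulus R (fun r => r ^ b) ∧
      ∀ z : ℂ, ‖z‖ ∉ E ∪ Icc 0 1 → f (z + η) / f z = Complex.exp (η * (deriv f z / f z) + R z) := by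
    -- The bound is required at every large `z`, so `R` is set to `0` at exceptional radii; at other
    -- radii up to `r₀` it is whatever makes the identity exact.
    have hpt : ∀ z : ℂ, ∃ ρ : ℂ, (r₀ < ‖z‖ → ‖ρ‖ ≤ K * ‖z‖ ^ b) ∧
        (‖z‖ ∉ E ∪ Icc 0 1 → f (z + η) / f z = Complex.exp (η * (deriv f z / f z) + ρ)) := by
      intro z
      by_cases hz : ‖z‖ ∈ E ∪ Icc 0 1
      · refine ⟨0, fun _ => ?_, fun h => absurd hz h⟩
        rw [norm_zero]
        positivity
      · rcases lt_or_ge r₀ ‖z‖ with h | h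
        · obtain ⟨ρ, hρ, hρn⟩ := hquot z hz h
          exact ⟨ρ, fun _ => hρn, fun _ => hρ⟩
        · obtain ⟨-, h₁, -, h₂⟩ := hreg z hz
          refine ⟨Complex.log (f (z + η) / f z) - η * (deriv f z / f z),
            fun h' => absurd h' (not_lt.2 h), fun _ => ?_⟩
          rw [add_sub_cancel, Complex.exp_log (div_ne_zero h₂ h₁)]
    choose R hR₁ hR₂ using hpt
    exact ⟨R, ⟨r₀, hr₀, K, hK, hR₁⟩, hR₂⟩
  refine ⟨E, hE, hEm, hEl, hreg, ?_, R, hRO, hR⟩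
  have hn : ∀ z : ℂ, ∃ n : ℤ, ‖z‖ ∉ E ∪ Icc 0 1 →
      2 * Real.pi * Complex.I * (n : ℂ) + Complex.log (f (z + η) / f z)
        = η * (deriv f z / f z) + R z := by
    intro z
    by_cases hz : ‖z‖ ∈ E ∪ Icc 0 1
    · exact ⟨0, fun h => absurd hz h⟩
    · obtain ⟨-, h₁, -, h₂⟩ := hreg z hz
      have h := Complex.exp_log (div_ne_zero h₂ h₁)
      rw [hR z hz] at h
      -- Two logarithms of the same quotient differ by a multiple of `2πi`.
      obtain ⟨n, hn⟩ := Complex.exp_eq_exp_iff_exists_int.1 h.symm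
      refine ⟨n, fun _ => ?_⟩
      rw [hR z hz]
      refine Eq.trans ?_ hn.symm
      ring
  choose n hn using hn
  exact ⟨n, R, hRO, hn⟩
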